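/- **Setting.** Let $S$ (latent states) and $A$ (actions, nonempty) be finite sets, $X$ a measurable space of observations and $H$ a horizon. Let $M^\circ=(S,A,s_{\mathrm{init}},H,T^\circ,R^\circ)$ be an episodic MDP with rewards in $[0,1]$ that is *deterministic*: $T^\circ_h(s'\mid s,a)\in\{0,1\}$. The target environment is a block MDP $\mathbf M^\star=(M^\star,X,q^\star)$: a latent episodic MDP $M^\star$ on $S,A,H$ with transitions $T^\star$ and rewards $R^\star$ in $[0,1]$, and emission distributions $q^\star(\cdot\mid s)$ on $X$, with a measurable perfect decoder $\phi^\star:X\to S$, i.e. $\phi^\star(x)=s$ for $q^\star(\cdot\mid s)$-almost every $x$. The agent sees only the observations. A practicable policy $\pi$ chooses $a_h=\pi_h(x_1,\dots,x_h)$, and $V^\pi_{\mathbf M^\star}$ is its expected total reward. The initial latent state of $M^\star$ may be random; $\varepsilon_0$ is the probability that it differs from $s_{\mathrm{init}}$. An MDP $M'$ is an *$\eta$-perturbation* of $M$ if there are distributions $\xi_h(\cdot\mid s,a)$ on $A$ with $\xi_h(a\mid s,a)\ge 1-\eta$, $T'_h(s'\mid s,a)=\sum_{a'}T_h(s'\mid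 s,a')\,\xi_h(a'\mid s,a)$ and $R'_h(s,a)=\sum_{a'}R_h(s,a')\,\xi_h(a'\mid s,a)$ for all $h,s,a,s'$. Assume that the transitions and rewards of $M^\star$ are an $\eta$-perturbation of those of $M^\circ$, for some $\eta<1/2$. Let $F$ be a finite set of measurable functions $f:X^2\to\Delta(A)$ that is *realizable*: for every step $h<H$ there is $f^\star_h\in F$ with $$f^\star_h(a\mid x,x')=\frac{T^\star_h(\phi^\star(x')\mid\phi^\star(x),a)}{\sum_{a'}T^\star_h(\phi^\star(x')\mid\phi^\star(x),a')}\qquad(a\in A)$$ for almost all observations $x,x'$ that can occur at steps $h$ and $h+1$. **Algorithm (TASID).** Input: $M^\circ,\eta,\varepsilon>0,\delta\in(0,1)$, an optimization oracle for $F$, and episodes of $\mathbf M^\star$. 1. Compute $\rho$ by robust dynamic programming: $\tilde V_{H+1}=0$ and, for $h=H,\dots,1$, $\tilde Q_h(s,a)=R^\circ_h(s,a)+\sum_{s'}T^\circ_h(s'\mid s,a)\tilde V_{h+1}(s')$, $\tilde V_h(s)=(1-\eta)\max_a\tilde Q_h(s,a)+\eta\min_a\tilde Q_h(s,a)$, $\rho_h(s)\in\arg\max_a\tilde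 Q_h(s,a)$. 2. Put $\pi_1(x)=\rho_1(s_{\mathrm{init}})$. For $h=1,\dots,H-1$: collect $n_D$ triples $(x_h,a_h,x_{h+1})$, each in a new episode, by following $\pi_1,\dots,\pi_{h-1}$ until $x_h$ is observed and then drawing $a_h$ uniformly from $A$; let $f_h\in F$ maximize the sum of $\ln f(a_h\mid x_h,x_{h+1})$ over these triples ($\ln 0=-\infty$); let $\alpha_h(x,x')\in\arg\max_a f_h(a\mid x,x')$; let $\phi_{h+1}(x_1,\dots,x_{h+1})$ be the state that $M^\circ$ reaches from $s_{\mathrm{init}}$ under the actions $\alpha_1(x_1,x_2),\dots,\alpha_h(x_h,x_{h+1})$; and put $\pi_{h+1}=\rho_{h+1}\circ\phi_{h+1}$. 3. Return $\pi=(\pi_1,\dots,\pi_H)$. Ties in every $\arg\max$ are broken arbitrarily (measurably). The sample size is $$n_D=\left\lfloor\frac{8H^2|A|^3\ln(|F|/\delta)}{\varepsilon(1-2\eta)^2}\right\rfloor .$$ **Theorem.** (i) $\rho$ is a robust abstract policy: it maximizes, over all $\psi$ choosing $a_h=\psi_h(s_h)$, the infimum of the value $V^\psi_M$ over all $\eta$-perturbations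 $M$ of $M^\circ$ with initial state $s_{\mathrm{init}}$. (ii) TASID executes $$n=(H-1)\,n_D\le\frac{8H^3|A|^3\ln(|F|/\delta)}{\varepsilon(1-2\eta)^2}$$ episodes, so in particular $n=O\!\left(\frac{H^4|A|^3\ln(|F|/\delta)}{\varepsilon(1-2\eta)^2}\right)$, independently of $|S|$ and $|X|$. (iii) With probability at least $1-\delta$ over its run, the returned practicable policy satisfies $$V^{\pi}_{\mathbf M^\star}\ \ge\ V^{\rho\circ\phi^\star}_{\mathbf M^\star}-\varepsilon-H\varepsilon_0 .$$ The same guarantee (iii) holds if $n_D$ is replaced by any larger integer. If $\varepsilon_0=0$, the bound is $V^{\pi}_{\mathbf M^\star}\ge V^{\rho\circ\phi^\star}_{\mathbf M^\star}-\varepsilon$. -/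

import Mathlib

open MeasureTheory
open scoped ENNReal

namespace TASID

noncomputable section

/-! ### Episodic MDPs

Steps are numbered `0, …, H - 1`.  Values of `T`, `R`, policies, … at indices `≥ H` are never
used. -/

/-- An episodic MDP with horizon `H`.  The initial state is drawn from `init`
(`PMF.pure s` for a fixed initial state `s`). -/
structure MDP (S A : Type*) (H : ℕ) where
  init : PMF S
  T : ℕ → S → A → PMF S
  R : ℕ → S → A → ℝ
  R_mem : ∀ h, h < H → ∀ s a, R h s a ∈ Set.Icc (0 : ℝ) 1

/-- An abstract (Markov, deterministic) policy `ψ_h(s)`. -/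
abbrev AbstractPolicy (S A : Type*) := ℕ → S → A

namespace MDP

variable {S A : Type*} {H : ℕ}

/-- All transition probabilities are `0` or `1`. -/
def Deterministic (M : MDP S A H) : Prop :=
  ∀ h, h < H → ∀ s a s', M.T h s a s' = 0 ∨ M.T h s a s' = 1

open Classical in
/-- The state that follows `s` under action `a` at step `h` in a deterministic MDP. -/
def next (M : MDP S A H) (h : ℕ) (s : S) (a : A) : S :=
  if hs : ∃ s', M.T h s a s' = 1 then hs.choose else s

/-- The law of the state at step `h` when following `ψ`. -/
def stateLaw (M : MDP S A H) (ψ : AbstractPolicy S A) : ℕ → PMF S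
  | 0 => M.init
  | h + 1 => (M.stateLaw ψ h).bind fun s => M.T h s (ψ h s)

/-- `V^ψ_M`, the expected total reward of `ψ` in `M`. -/
def value [Fintype S] (M : MDP S A H) (ψ : AbstractPolicy S A) : ℝ :=
  ∑ h ∈ Finset.range H, ∑ s, (M.stateLaw ψ h s).toReal * M.R h s (ψ h s)

/-- The transitions and rewards of `M'` are obtained from those of `M` by replacing each action
`a` by a random action drawn from `ξ_h(· | s, a)`, which keeps `a` with probability at least
`1 - η`. -/
def IsPerturbation [Fintype A] (η : ℝ) (M M' : MDP S A H) : Prop :=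
  ∃ ξ : ℕ → S → A → PMF A,
    (∀ h, h < H → ∀ s a, 1 - η ≤ (ξ h s a a).toReal) ∧
    (∀ h, h < H → ∀ s a s', M'.T h s a s' = ∑ a', M.T h s a' s' * ξ h s a a') ∧
    (∀ h, h < H → ∀ s a, M'.R h s a = ∑ a', M.R h s a' * (ξ h s a a').toReal)

/-- The worst value of `ψ` over all `η`-perturbations of `M` with the same initial state. -/
def worstValue [Fintype S] [Fintype A] (M : MDP S A H) (η : ℝ) (ψ : AbstractPolicy S A) : ℝ :=
  sInf {v | ∃ M' : MDP S A H, M'.init = M.init ∧ IsPerturbation η M M' ∧ v = M'.value ψ}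

/-- `ρ` is a robust abstract policy: it maximizes the worst-case value. -/
def IsRobust [Fintype S] [Fintype A] (M : MDP S A H) (η : ℝ) (ρ : AbstractPolicy S A) : Prop :=
  ∀ ψ : AbstractPolicy S A, M.worstValue η ψ ≤ M.worstValue η ρ

/-- `ρ` is returned by robust dynamic programming on `M` at level `η` (ties in the `argmax` are
broken arbitrarily). -/
def IsRDPOutput [Fintype S] (M : MDP S A H) (η : ℝ) (ρ : AbstractPolicy S A) : Prop :=
  ∃ (Q : ℕ → S → A → ℝ) (V : ℕ → S → ℝ),
    (∀ s, V H s = 0) ∧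
    ∀ h, h < H →
      (∀ s a, Q h s a = M.R h s a + ∑ s', (M.T h s a s').toReal * V (h + 1) s') ∧
      (∀ s, V h s = (1 - η) * (⨆ a, Q h s a) + η * (⨅ a, Q h s a)) ∧
      (∀ s a, Q h s a ≤ Q h s (ρ h s))

/-- The states that occur with positive probability at step `h` under some choice of actions. -/
def Reachable (M : MDP S A H) : ℕ → S → Prop
  | 0, s => M.init s ≠ 0
  | h + 1, s' => ∃ s a, M.Reachable h s ∧ M.T h s a s' ≠ 0

end MDP

/-! ### Block MDPs and practicable policies -/

/-- A block MDP: a latent MDP, an emission distribution for every latent state, and the perfect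
decoder, which recovers the latent state from an observation (equivalently, the emission
distributions live on the disjoint measurable sets `decoder ⁻¹' {s}`). -/
structure BlockMDP (S A X : Type*) [MeasurableSpace S] [MeasurableSpace X] (H : ℕ) where
  latent : MDP S A H
  emit : S → Measure X
  emit_prob : ∀ s, IsProbabilityMeasure (emit s)
  decoder : X → S
  measurable_decoder : Measurable decoder
  decoder_emit : ∀ s, ∀ᵐ x ∂(emit s), decoder x = s

/-- A practicable policy: the action at step `k` is a function of the observations `x_0, …, x_k`. -/
abbrev Policy (X A : Type*) := (k : ℕ) → (Fin (k + 1) → X) → A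

namespace BlockMDP

variable {S A X : Type*} [MeasurableSpace S] [MeasurableSpace X] {H : ℕ}

/-- The conditional law of the latent state at step `h`, given the observations and latent states
at steps `0, …, h - 1`, when actions are chosen by `π`. -/
def nextState (B : BlockMDP S A X H) (π : Policy X A) : (h : ℕ) → (Fin h → X × S) → PMF S
  | 0, _ => B.latent.init
  | k + 1, τ => B.latent.T k (τ (Fin.last k)).2 (π k fun i => (τ i).1)

/-- The joint law of the observations and latent states at steps `0, …, h - 1` of an episode in
which actions are chosen by `π`. -/
def trajLaw (B : BlockMDP S A X H) (π : Policy X A) : (h : ℕ) → Measure (Fin h → X × S)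
  | 0 => Measure.dirac Fin.elim0
  | h + 1 => (B.trajLaw π h).bind fun τ =>
      (B.nextState π h τ).toMeasure.bind fun s =>
        (B.emit s).map fun x => Fin.snoc (α := fun _ => X × S) τ (x, s)

/-- The total reward of an episode with observations and latent states `τ` and actions chosen
by `π`. -/
def totalReward (B : BlockMDP S A X H) (π : Policy X A) (τ : Fin H → X × S) : ℝ :=
  ∑ k : Fin H, B.latent.R k (τ k).2
    (π k fun i => (τ ⟨i, lt_of_lt_of_le i.isLt k.isLt⟩).1)

/-- `V^π_B`, the expected total reward of the practicable policy `π`. -/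
def value (B : BlockMDP S A X H) (π : Policy X A) : ℝ :=
  ∫ τ, B.totalReward π τ ∂(B.trajLaw π H)

/-- The Markov practicable policy `ρ ∘ φ⋆`, with `φ⋆` the perfect decoder. -/
def compDecoder (B : BlockMDP S A X H) (ρ : AbstractPolicy S A) : Policy X A :=
  fun k xs => ρ k (B.decoder (xs (Fin.last k)))

/-- Every inverse-dynamics posterior is in `F`.  The emission density of `x'` cancels in
`𝐓_h(x' | x, a) / ∑ a', 𝐓_h(x' | x, a')`, `𝐓_h(x' | x, a) = q(x' | s') T_h(s' | s, a)`, where `s`,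
`s'` are the latent states of `x`, `x'`.  Observations `x`, `x'` that can occur at steps `h` and
`h + 1` are those emitted by a reachable state `s` and by a successor `s'` of `s`. -/
def Realizable [Fintype A] (B : BlockMDP S A X H) (F : Finset (X → X → PMF A)) : Prop :=
  ∀ h, h + 1 < H → ∃ f ∈ F, ∀ s s', B.latent.Reachable h s →
    (∃ a, B.latent.T h s a s' ≠ 0) →
      ∀ᵐ x ∂(B.emit s), ∀ᵐ x' ∂(B.emit s'), ∀ a,
        f x x' a = B.latent.T h s a s' / ∑ a', B.latent.T h s a' s'

/-- The law of the triple `(x_h, a_h, x_{h+1})` recorded in one episode in which `π` is followed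
until `x_h` is observed and `a_h` is then drawn uniformly. -/
def sampleLaw [Fintype A] [Nonempty A] [MeasurableSpace A]
    (B : BlockMDP S A X H) (π : Policy X A) (h : ℕ) : Measure (X × A × X) :=
  (B.trajLaw π (h + 1)).bind fun τ =>
    (PMF.uniformOfFintype A).toMeasure.bind fun a =>
      (B.latent.T h (τ (Fin.last h)).2 a).toMeasure.bind fun s' =>
        (B.emit s').map fun x' => ((τ (Fin.last h)).1, a, x')

end BlockMDP

/-! ### The algorithm -/

section Algorithm

variable {S A X : Type*} [MeasurableSpace A] [MeasurableSpace X]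

/-- Log-likelihood of the actions of the dataset `D` under `f`, with `log 0 = -∞`. -/
def logLikelihood {n : ℕ} (f : X → X → PMF A) (D : Fin n → X × A × X) : EReal :=
  ∑ i, ENNReal.log (f (D i).1 (D i).2.2 (D i).2.1)

/-- An optimization oracle for `F`: it returns a maximizer of the log-likelihood over `F`. -/
structure OptOracle (F : Finset (X → X → PMF A)) (n : ℕ) where
  opt : (Fin n → X × A × X) → X → X → PMF A
  opt_mem : ∀ D, opt D ∈ F
  opt_max : ∀ D, ∀ f ∈ F, logLikelihood f D ≤ logLikelihood (opt D) D
  measurableSet_opt : ∀ f, MeasurableSet {D | opt D = f}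

/-- A choice of `argmax_a f(a | x, x')` for the functions `f` in `F`. -/
structure ArgmaxRule (F : Finset (X → X → PMF A)) where
  pick : (X → X → PMF A) → X → X → A
  pick_max : ∀ f ∈ F, ∀ x x' a, f x x' a ≤ f x x' (pick f x x')
  measurable_pick : ∀ f ∈ F, Measurable fun p : X × X => pick f p.1 p.2

/-- The shadow action decoders `α_h` learned from the datasets `D 0, …, D (m - 1)`
(arbitrary for `h ≥ m`). -/
def shadowDecoder [Nonempty A] {F : Finset (X → X → PMF A)} {n m : ℕ} (O : OptOracle F n)
    (G : ArgmaxRule F) (D : Fin m → Fin n → X × A × X) (h : ℕ) (x x' : X) : A :=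
  if hm : h < m then G.pick (O.opt (D ⟨h, hm⟩)) x x' else Classical.arbitrary A

/-- The state reached in the simulator `M` from `s₀` by executing the shadow actions
`α_0(x_0, x_1), …, α_{k-1}(x_{k-1}, x_k)`. -/
def stateDecoder {H : ℕ} (M : MDP S A H) (s₀ : S) (α : ℕ → X → X → A) :
    (k : ℕ) → (Fin (k + 1) → X) → S
  | 0, _ => s₀
  | k + 1, xs =>
      M.next k (stateDecoder M s₀ α k fun i => xs i.castSucc)
        (α k (xs (Fin.last k).castSucc) (xs (Fin.last (k + 1))))

/-- The practicable policy built from the datasets `D 0, …, D (m - 1)`; at the steps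
`0, …, m` it only uses learned shadow action decoders. -/
def learnedPolicy [Nonempty A] {H : ℕ} {F : Finset (X → X → PMF A)} {n m : ℕ} (M : MDP S A H)
    (s₀ : S) (ρ : AbstractPolicy S A) (O : OptOracle F n) (G : ArgmaxRule F)
    (D : Fin m → Fin n → X × A × X) : Policy X A :=
  fun k xs => ρ k (stateDecoder M s₀ (shadowDecoder O G D) k xs)

/-- The joint law of the first `m` datasets collected by the algorithm in the target environment
`B`.  The `n` triples of dataset `m` are recorded in `n` independent episodes that follow the
policy built from the previous datasets. -/
def dataLaw [Fintype A] [Nonempty A] [MeasurableSpace S] {H : ℕ} {F : Finset (X → X → PMF A)}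
    {n : ℕ} (B : BlockMDP S A X H) (M : MDP S A H) (s₀ : S) (ρ : AbstractPolicy S A)
    (O : OptOracle F n) (G : ArgmaxRule F) : (m : ℕ) → Measure (Fin m → Fin n → X × A × X)
  | 0 => Measure.dirac Fin.elim0
  | m + 1 => (dataLaw B M s₀ ρ O G m).bind fun D =>
      (Measure.pi fun _ : Fin n => B.sampleLaw (learnedPolicy M s₀ ρ O G D) m).map
        fun d => Fin.snoc (α := fun _ => Fin n → X × A × X) D d

/-- The number of episodes of a run with horizon `H`: one for each of the `n` triples of each of
the `H - 1` datasets. -/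
def episodes (H n : ℕ) : ℕ := Fintype.card (Fin (H - 1) × Fin n)

/-- The number `n_D` of triples per dataset prescribed by the algorithm, rounded down. -/
def sampleSize (H cardA cardF : ℕ) (η ε δ : ℝ) : ℕ :=
  ⌊8 * (H : ℝ) ^ 2 * (cardA : ℝ) ^ 3 * Real.log (cardF / δ) / (ε * (1 - 2 * η) ^ 2)⌋₊

end Algorithm

end

end TASID

open TASID

set_option linter.unusedSectionVars false

namespace TASID

/-! Robustness of `ρ`. Both halves come from the performance-difference identity `value_sub_init`,
applied with the dynamic-programming values `V`. Under any `η`-perturbation the action of `ρ`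
survives with mass at least `1 - η`, so the one-step lookahead of `V` is at least `V`, and the worst
value of `ρ` is at least the initial average of `V`. Conversely, the perturbation that swaps in a
minimizer of `Q` with probability `η` holds every policy to at most that average.

Learning. When actions are uniform, the recorded action given `(x, x')` follows the inverse-dynamics
posterior `f⋆`. Since `x'` did occur, some action `g` leads to its state in the simulator, and `g`
has true transition probability at least `1 - η`. If the decoder picks an action `b` that does not
lead there, `b` has probability at most `η`, although the fitted `f` ranks `b` at least as high as
`g`. So `f` and `f⋆` are far apart in Hellinger distance at `(x, x')` (`sum_sqrt_add_le_one`).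
Averaging, the mean of `√(f / f⋆)` is at most `1 - c p ≤ exp (-c p)`, where `p` is the error
probability of the decoder of `f` and `c` is `affinityGap`.

A likelihood maximizer has likelihood ratio at least `1` against `f⋆`. Summing the square-root
ratios over `F` bounds the mean of `exp (n c p)` by `|F|` (`lintegral_exp_mle_le`). Conditioning on
earlier datasets multiplies these bounds, so the exponential moment of the total error of a run is
at most `|F| ^ (H - 1)` (`lintegral_exp_keyError_le`). One application of Markov's inequality to the
whole run replaces a union bound over steps and saves a logarithm of `H`.

Transfer. The returned policy copies `ρ ∘ φ⋆` until its first decoding error. An error in the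
initial state has probability `ε₀`; an error of the decoder of step `k` has probability at most
`|A|` times its error under uniform actions. Each failure costs at most `H`
(`value_compDecoder_sub_le`). The constant `8` is twice what this needs and absorbs the rounding of
the sample size. -/

theorem _root_.PMF.toReal_le_one {α : Type*} (p : PMF α) (a : α) : (p a).toReal ≤ 1 :=
  ENNReal.toReal_le_of_le_ofReal zero_le_one (by simpa using p.coe_le_one a)

theorem _root_.PMF.sum_eq_one {α : Type*} [Fintype α] (p : PMF α) : ∑ a, p a = 1 := by
  rw [← tsum_fintype (L := .unconditional _)]; exact p.tsum_coe

theorem _root_.PMF.sum_toReal {α : Type*} [Fintype α] (p : PMF α) : ∑ a, (p a).toReal = 1 := by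
  rw [← ENNReal.toReal_sum fun a _ => p.apply_ne_top a, p.sum_eq_one, ENNReal.toReal_one]

theorem _root_.PMF.toReal_bind_apply {α β : Type*} [Fintype α] (p : PMF α) (f : α → PMF β) (b : β) :
    (p.bind f b).toReal = ∑ a, (p a).toReal * (f a b).toReal := by
  rw [PMF.bind_apply, tsum_fintype, ENNReal.toReal_sum]
  · simp [ENNReal.toReal_mul]
  · exact fun a _ => ENNReal.mul_ne_top (p.apply_ne_top a) ((f a).apply_ne_top b)

/-! ### Robust dynamic programming. -/

namespace MDP

variable {S A : Type*} {H : ℕ}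

/-- The performance-difference identity, for arbitrary functions `U` in place of the value
functions. -/
theorem value_sub_init [Fintype S] (M : MDP S A H) (ψ : AbstractPolicy S A) (U : ℕ → S → ℝ)
    (hU : ∀ s, U H s = 0) :
    M.value ψ - ∑ s, (M.init s).toReal * U 0 s =
      ∑ h ∈ Finset.range H, ∑ s, (M.stateLaw ψ h s).toReal *
        (M.R h s (ψ h s) + ∑ s', (M.T h s (ψ h s) s').toReal * U (h + 1) s' - U h s) := by
  have key : ∀ h, ∑ s, (M.stateLaw ψ h s).toReal *
        (M.R h s (ψ h s) + ∑ s', (M.T h s (ψ h s) s').toReal * U (h + 1) s' - U h s) =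
      ∑ s, (M.stateLaw ψ h s).toReal * M.R h s (ψ h s) +
      (∑ s, (M.stateLaw ψ (h + 1) s).toReal * U (h + 1) s -
        ∑ s, (M.stateLaw ψ h s).toReal * U h s) := by
    intro h
    have : ∑ s, (M.stateLaw ψ (h + 1) s).toReal * U (h + 1) s =
        ∑ s, (M.stateLaw ψ h s).toReal *
          ∑ s', (M.T h s (ψ h s) s').toReal * U (h + 1) s' := by
      simp only [stateLaw, PMF.toReal_bind_apply, Finset.sum_mul, Finset.mul_sum]
      rw [Finset.sum_comm]
      simp only [mul_assoc]
    rw [this, ← Finset.sum_sub_distrib, ← Finset.sum_add_distrib]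
    exact Finset.sum_congr rfl fun s _ => by ring
  simp only [key, Finset.sum_add_distrib]
  rw [Finset.sum_range_sub fun h => ∑ s, (M.stateLaw ψ h s).toReal * U h s]
  simp [value, stateLaw, hU, sub_eq_add_neg]

theorem value_nonneg [Fintype S] (M : MDP S A H) (ψ : AbstractPolicy S A) : 0 ≤ M.value ψ :=
  Finset.sum_nonneg fun h hh => Finset.sum_nonneg fun s _ =>
    mul_nonneg ENNReal.toReal_nonneg (M.R_mem h (Finset.mem_range.1 hh) s _).1

/-- The perturbation of `M` in which actions are replaced according to `ξ`. -/
noncomputable def perturb [Fintype A] (M : MDP S A H) (ξ : ℕ → S → A → PMF A) : MDP S A H where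
  init := M.init
  T h s a := (ξ h s a).bind (M.T h s)
  R h s a := ∑ a', M.R h s a' * (ξ h s a a').toReal
  R_mem h hh s a := by
    refine ⟨Finset.sum_nonneg fun a' _ => mul_nonneg (M.R_mem h hh s a').1
      ENNReal.toReal_nonneg, ?_⟩
    rw [← (ξ h s a).sum_toReal]
    exact Finset.sum_le_sum fun a' _ => mul_le_of_le_one_left ENNReal.toReal_nonneg
      (M.R_mem h hh s a').2

theorem isPerturbation_perturb [Fintype A] (M : MDP S A H) {η : ℝ} (ξ : ℕ → S → A → PMF A)
    (hξ : ∀ h, h < H → ∀ s a, 1 - η ≤ (ξ h s a a).toReal) :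
    IsPerturbation η M (M.perturb ξ) :=
  ⟨ξ, hξ, fun h _ s a s' => by
    simp [perturb, PMF.bind_apply, tsum_fintype, mul_comm], fun _ _ _ _ => rfl⟩

/-- One-step lookahead in a perturbation is the `ξ`-average of the lookahead in `M`. -/
theorem lookahead_perturbed [Fintype S] [Fintype A] {M M' : MDP S A H} {h : ℕ} {s : S} {a : A} {ξ : PMF A}
    (hT : ∀ s', M'.T h s a s' = ∑ a', M.T h s a' s' * ξ a')
    (hR : M'.R h s a = ∑ a', M.R h s a' * (ξ a').toReal) (U : S → ℝ) :
    M'.R h s a + ∑ s', (M'.T h s a s').toReal * U s' =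
      ∑ a', (ξ a').toReal * (M.R h s a' + ∑ s', (M.T h s a' s').toReal * U s') := by
  have : ∀ s', (M'.T h s a s').toReal = ∑ a', (ξ a').toReal * (M.T h s a' s').toReal := by
    intro s'
    rw [hT, ENNReal.toReal_sum]
    · simp [ENNReal.toReal_mul, mul_comm]
    · exact fun a' _ => ENNReal.mul_ne_top (PMF.apply_ne_top _ _) (ξ.apply_ne_top a')
  simp only [this, hR, mul_add, Finset.sum_add_distrib, Finset.mul_sum, Finset.sum_mul]
  rw [Finset.sum_comm (s := Finset.univ (α := S))]
  simp only [mul_assoc, mul_comm]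

/-- A distribution that puts mass at least `1 - η` on a maximizer of `Q` averages `Q` to at least
`(1 - η) max Q + η min Q`. -/
theorem robust_le_average [Fintype A] {ξ : PMF A} {η : ℝ} {Q : A → ℝ} {a : A}
    (hξ : 1 - η ≤ (ξ a).toReal) (ha : ∀ b, Q b ≤ Q a) :
    (1 - η) * (⨆ b, Q b) + η * (⨅ b, Q b) ≤ ∑ b, (ξ b).toReal * Q b := by
  classical
  have : Nonempty A := ⟨a⟩
  have hsup : ⨆ b, Q b = Q a := le_antisymm (ciSup_le ha) (le_ciSup (Set.finite_range Q).bddAbove a)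
  set m := ⨅ b, Q b with hm
  have hmle : ∀ b, m ≤ Q b := fun b => ciInf_le (Set.finite_range Q).bddBelow b
  have h1 : (ξ a).toReal * (Q a - m) ≤ ∑ b, (ξ b).toReal * (Q b - m) :=
    Finset.single_le_sum (f := fun b => (ξ b).toReal * (Q b - m))
      (fun b _ => mul_nonneg ENNReal.toReal_nonneg (sub_nonneg.2 (hmle b))) (Finset.mem_univ a)
  have h2 : ∑ b, (ξ b).toReal * (Q b - m) = ∑ b, (ξ b).toReal * Q b - m := by
    simp only [mul_sub, Finset.sum_sub_distrib, ← Finset.sum_mul, ξ.sum_toReal, one_mul]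
  have h3 := mul_le_mul_of_nonneg_right hξ (sub_nonneg.2 (hmle a))
  rw [hsup]
  linarith

open Classical in
/-- The distribution that mixes `a` with weight `1 - η` and `b` with weight `η`. -/
noncomputable def mixPMF [Fintype A] (η : ℝ) (h0 : 0 ≤ η) (h1 : η ≤ 1) (a b : A) : PMF A :=
  PMF.ofFintype
    (fun c => ENNReal.ofReal ((1 - η) * (if c = a then 1 else 0) + η * (if c = b then 1 else 0)))
    (by
      rw [← ENNReal.ofReal_sum_of_nonneg]
      · simp [Finset.sum_add_distrib]
      · intro c _
        have := sub_nonneg.2 h1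
        positivity)

theorem sum_mixPMF [Fintype A] {η : ℝ} (h0 : 0 ≤ η) (h1 : η ≤ 1) (a b : A) (Q : A → ℝ) :
    ∑ c, (mixPMF η h0 h1 a b c).toReal * Q c = (1 - η) * Q a + η * Q b := by
  classical
  have : ∀ c, (mixPMF η h0 h1 a b c).toReal =
      (1 - η) * (if c = a then 1 else 0) + η * (if c = b then 1 else 0) := by
    intro c
    have := sub_nonneg.2 h1
    rw [mixPMF, PMF.ofFintype_apply, ENNReal.toReal_ofReal (by positivity)]
  simp [this, add_mul, Finset.sum_add_distrib]

theorem le_mixPMF [Fintype A] {η : ℝ} (h0 : 0 ≤ η) (h1 : η ≤ 1) (a b : A) :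
    1 - η ≤ (mixPMF η h0 h1 a b a).toReal := by
  classical
  have := sum_mixPMF h0 h1 a b (Pi.single a 1)
  simp only [Pi.single_apply, mul_ite, mul_one, mul_zero, Finset.sum_ite_eq', Finset.mem_univ,
    if_true] at this
  rw [this]
  split_ifs <;> linarith

theorem isRobust_of_isRDPOutput [Fintype S] [Fintype A] [Nonempty A] (M : MDP S A H) {η : ℝ}
    (hη : η < 1 / 2) {M₁ : MDP S A H} (hpert : IsPerturbation η M M₁) {ρ : AbstractPolicy S A}
    (hρ : M.IsRDPOutput η ρ) : M.IsRobust η ρ := by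
  intro ψ
  obtain ⟨s₁⟩ : Nonempty S := M.init.support_nonempty.to_type
  rcases Nat.eq_zero_or_pos H with rfl | hH
  · simp [worstValue, value]
  obtain ⟨Q, V, hV, hQV⟩ := hρ
  -- Nonnegativity of `η` is forced by the existence of a perturbation, since `1 - η` is at most a
  -- probability. This needs a step, hence `H > 0`.
  have h0 : 0 ≤ η := by
    obtain ⟨ξ, hξ, -⟩ := hpert
    have := hξ 0 hH s₁ (Classical.arbitrary A)
    linarith [(ξ 0 s₁ (Classical.arbitrary A)).toReal_le_one (Classical.arbitrary A)]
  have h1 : η ≤ 1 := by linarith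
  have hlow : ∑ s, (M.init s).toReal * V 0 s ≤ M.worstValue η ρ := by
    -- The infimum runs over a nonempty set: the given perturbation, restarted from the initial law
    -- of `M`, belongs to it.
    refine le_csInf ⟨_, { M₁ with init := M.init }, rfl, hpert, rfl⟩ ?_
    rintro v ⟨M', hM', ⟨ξ, hξ, hT, hR⟩, rfl⟩
    rw [← sub_nonneg, ← hM', value_sub_init M' ρ V hV]
    refine Finset.sum_nonneg fun h hh => Finset.sum_nonneg fun s _ =>
      mul_nonneg ENNReal.toReal_nonneg (sub_nonneg.2 ?_)
    have hh := Finset.mem_range.1 hh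
    obtain ⟨hQ, hVh, hmax⟩ := hQV h hh
    rw [lookahead_perturbed (hT h hh s _) (hR h hh s _), hVh]
    simp only [← hQ]
    exact robust_le_average (hξ h hh s _) (hmax s)
  have hmin : ∀ h s, ∃ b, ∀ a, Q h s b ≤ Q h s a := fun h s => Finite.exists_min (Q h s)
  choose b hb using hmin
  refine le_trans ?_ hlow
  -- The adversary keeps the chosen action with weight `1 - η` and otherwise plays a minimizer of
  -- `Q`. It does not depend on `ψ`.
  let ξ : ℕ → S → A → PMF A := fun h s a => mixPMF η h0 h1 a (b h s)
  have hbdd : BddBelow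
      {v | ∃ M' : MDP S A H, M'.init = M.init ∧ IsPerturbation η M M' ∧ v = M'.value ψ} := by
    refine ⟨0, ?_⟩
    rintro v ⟨M', -, -, rfl⟩
    exact M'.value_nonneg ψ
  have hle : M.worstValue η ψ ≤ (M.perturb ξ).value ψ := csInf_le hbdd ⟨M.perturb ξ, rfl,
    isPerturbation_perturb M ξ fun h _ s a => le_mixPMF h0 h1 a _, rfl⟩
  refine hle.trans ?_
  · change (M.perturb ξ).value ψ ≤ ∑ s, ((M.perturb ξ).init s).toReal * V 0 s
    rw [← sub_nonpos, value_sub_init _ ψ V hV]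
    refine Finset.sum_nonpos fun h hh => Finset.sum_nonpos fun s _ =>
      mul_nonpos_of_nonneg_of_nonpos ENNReal.toReal_nonneg (sub_nonpos.2 ?_)
    have hh := Finset.mem_range.1 hh
    obtain ⟨hQ, hVh, hmax⟩ := hQV h hh
    rw [lookahead_perturbed (ξ := ξ h s (ψ h s)) (M := M)
      (fun s' => by simp [perturb, PMF.bind_apply, tsum_fintype, mul_comm]) rfl, hVh]
    simp only [← hQ, ξ]
    rw [sum_mixPMF]
    gcongr
    · exact le_ciSup (Set.finite_range (Q h s)).bddAbove _
    · exact le_ciInf (hb h s)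

end MDP

/-! ### Integrals against laws built by `bind` over a finite set. -/

section Kernels

variable {S X Ω E : Type*} [Fintype S] [MeasurableSpace S] [MeasurableSingletonClass S]
  [MeasurableSpace X] [MeasurableSpace Ω] [MeasurableSpace E]

theorem lintegral_toMeasure (p : PMF S) (f : S → ℝ≥0∞) :
    ∫⁻ s, f s ∂p.toMeasure = ∑ s, p s * f s := by
  rw [lintegral_fintype]
  simp_rw [PMF.toMeasure_apply_singleton p _ (measurableSet_singleton _), mul_comm]

theorem lintegral_toMeasure_bind (p : PMF S) (μ : S → Measure E) {f : E → ℝ≥0∞}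
    (hf : Measurable f) :
    ∫⁻ y, f y ∂(p.toMeasure.bind μ) = ∑ s, p s * ∫⁻ y, f y ∂(μ s) := by
  rw [Measure.lintegral_bind Measurable.of_discrete.aemeasurable hf.aemeasurable,
    lintegral_toMeasure]

theorem lintegral_toMeasure_bind_map (p : PMF S) (μ : S → Measure X) {g : S → X → E}
    (hg : ∀ s, Measurable (g s)) {f : E → ℝ≥0∞} (hf : Measurable f) :
    ∫⁻ y, f y ∂(p.toMeasure.bind fun s => (μ s).map (g s)) =
      ∑ s, p s * ∫⁻ x, f (g s x) ∂(μ s) := by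
  rw [lintegral_toMeasure_bind p _ hf]
  simp_rw [lintegral_map hf (hg _)]

/-- The kernels below have integrals given by explicit finite sums, from which measurability can be
read off; `Measure.lintegral_bind` asks for it each time. -/
theorem measurable_of_lintegral {κ : Ω → Measure E}
    (h : ∀ f : E → ℝ≥0∞, Measurable f → Measurable fun ω => ∫⁻ y, f y ∂(κ ω)) : Measurable κ := by
  refine Measure.measurable_of_measurable_coe _ fun s hs => ?_
  simpa [lintegral_indicator hs] using h (s.indicator 1) (measurable_one.indicator hs)

theorem measurable_sum_mul_lintegral {p : Ω → S → ℝ≥0∞} (hp : ∀ s, Measurable fun ω => p ω s)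
    (μ : S → Measure X) [∀ s, SFinite (μ s)] {f : Ω → S → X → ℝ≥0∞}
    (hf : ∀ s, Measurable fun q : Ω × X => f q.1 s q.2) :
    Measurable fun ω => ∑ s, p ω s * ∫⁻ x, f ω s x ∂(μ s) :=
  Finset.measurable_sum _ fun s _ => (hp s).mul (Measurable.lintegral_prod_right' (hf s))

theorem measurable_snoc {Y : Type*} [MeasurableSpace Y] (n : ℕ) :
    Measurable fun q : (Fin n → Y) × Y => Fin.snoc (α := fun _ => Y) q.1 q.2 := by
  refine measurable_pi_lambda _ fun i => ?_
  refine Fin.lastCases ?_ (fun j => ?_) i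
  · simpa using measurable_snd
  · simpa using (by fun_prop : Measurable fun q : (Fin n → Y) × Y => q.1 j)

end Kernels

/-! ### Laws of trajectories and of recorded triples. -/

section Episodes

variable {S A X : Type*} [Fintype S] [MeasurableSpace S] [MeasurableSingletonClass S]
  [MeasurableSpace A] [MeasurableSpace X] {H : ℕ}

namespace BlockMDP

instance (B : BlockMDP S A X H) (s : S) : IsProbabilityMeasure (B.emit s) := B.emit_prob s

theorem measurable_nextState [Finite A] [MeasurableSingletonClass A] (B : BlockMDP S A X H)
    {π : Policy X A} (hπ : ∀ k, Measurable (π k)) (h : ℕ) (s : S) :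
    Measurable fun τ => B.nextState π h τ s := by
  cases h with
  | zero => exact measurable_const (a := B.latent.init s)
  | succ k =>
    have hT : Measurable fun q : S × A => B.latent.T k q.1 q.2 s := Measurable.of_discrete
    exact hT.comp ((by fun_prop : Measurable fun τ : Fin (k + 1) → X × S => (τ (Fin.last k)).2).prodMk
      ((hπ k).comp (by fun_prop)))

theorem nextState_congr (B : BlockMDP S A X H) {π π' : Policy X A} {h : ℕ}
    (hπ : ∀ k < h, π k = π' k) : B.nextState π h = B.nextState π' h := by
  cases h with
  | zero => rfl
  | succ k => funext τ; simp only [nextState, hπ k k.lt_succ_self]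

theorem trajLaw_congr (B : BlockMDP S A X H) {π π' : Policy X A} {h : ℕ}
    (hπ : ∀ k, k + 1 < h → π k = π' k) : B.trajLaw π h = B.trajLaw π' h := by
  induction h with
  | zero => rfl
  | succ h ih =>
    rw [trajLaw, trajLaw, ih fun k hk => hπ k (by omega),
      B.nextState_congr fun k hk => hπ k (by omega)]

theorem measurable_snoc_pair (h : ℕ) (s : S) :
    Measurable fun q : (Fin h → X × S) × X => Fin.snoc (α := fun _ => X × S) q.1 (q.2, s) :=
  (measurable_snoc h).comp (measurable_fst.prodMk (measurable_snd.prodMk measurable_const))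

theorem lintegral_trajLaw_succ [Finite A] [MeasurableSingletonClass A] (B : BlockMDP S A X H)
    {π : Policy X A} (hπ : ∀ k, Measurable (π k)) (h : ℕ) {f : (Fin (h + 1) → X × S) → ℝ≥0∞}
    (hf : Measurable f) :
    ∫⁻ τ, f τ ∂(B.trajLaw π (h + 1)) =
      ∫⁻ τ, ∑ s, B.nextState π h τ s *
        ∫⁻ x, f (Fin.snoc (α := fun _ => X × S) τ (x, s)) ∂(B.emit s) ∂(B.trajLaw π h) := by
  have key : ∀ (τ : Fin h → X × S) (g : (Fin (h + 1) → X × S) → ℝ≥0∞), Measurable g →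
      ∫⁻ y, g y ∂((B.nextState π h τ).toMeasure.bind fun s =>
        (B.emit s).map fun x => Fin.snoc (α := fun _ => X × S) τ (x, s)) =
      ∑ s, B.nextState π h τ s *
        ∫⁻ x, g (Fin.snoc (α := fun _ => X × S) τ (x, s)) ∂(B.emit s) := fun τ g hg =>
    lintegral_toMeasure_bind_map _ _
      (fun s => (measurable_snoc_pair h s).comp measurable_prodMk_left) hg
  rw [trajLaw, Measure.lintegral_bind _ hf.aemeasurable]
  · simp_rw [key _ f hf]
  · refine (measurable_of_lintegral fun g hg => ?_).aemeasurable
    simp_rw [key _ g hg]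
    exact measurable_sum_mul_lintegral (fun s => B.measurable_nextState hπ h s) _
      fun s => hg.comp (measurable_snoc_pair h s)

theorem isProbabilityMeasure_trajLaw [Finite A] [MeasurableSingletonClass A]
    (B : BlockMDP S A X H) {π : Policy X A} (hπ : ∀ k, Measurable (π k)) (h : ℕ) :
    IsProbabilityMeasure (B.trajLaw π h) := by
  induction h with
  | zero => rw [trajLaw]; infer_instance
  | succ h ih =>
    constructor
    have := B.lintegral_trajLaw_succ hπ h (f := fun _ => 1) measurable_const
    simpa [PMF.sum_eq_one] using this

variable [Fintype A] [Nonempty A] [MeasurableSingletonClass A]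

theorem sampleLaw_congr (B : BlockMDP S A X H) {π π' : Policy X A} {h : ℕ}
    (hπ : ∀ k < h, π k = π' k) : B.sampleLaw π h = B.sampleLaw π' h := by
  rw [sampleLaw, sampleLaw, B.trajLaw_congr fun k hk => hπ k (by omega)]

theorem lintegral_sampleLaw (B : BlockMDP S A X H) (π : Policy X A) (h : ℕ)
    {f : X × A × X → ℝ≥0∞} (hf : Measurable f) :
    ∫⁻ y, f y ∂(B.sampleLaw π h) =
      ∫⁻ τ, ∑ a, (Fintype.card A : ℝ≥0∞)⁻¹ * ∑ s', B.latent.T h (τ (Fin.last h)).2 a s' *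
        ∫⁻ x', f ((τ (Fin.last h)).1, a, x') ∂(B.emit s') ∂(B.trajLaw π (h + 1)) := by
  have key : ∀ (τ : Fin (h + 1) → X × S) (g : X × A × X → ℝ≥0∞), Measurable g →
      ∫⁻ y, g y ∂((PMF.uniformOfFintype A).toMeasure.bind fun a =>
        (B.latent.T h (τ (Fin.last h)).2 a).toMeasure.bind fun s' =>
        (B.emit s').map fun x' => ((τ (Fin.last h)).1, a, x')) =
      ∑ a, (Fintype.card A : ℝ≥0∞)⁻¹ * ∑ s', B.latent.T h (τ (Fin.last h)).2 a s' *
        ∫⁻ x', g ((τ (Fin.last h)).1, a, x') ∂(B.emit s') := by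
    intro τ g hg
    rw [lintegral_toMeasure_bind _ _ hg]
    refine Finset.sum_congr rfl fun a _ => ?_
    rw [PMF.uniformOfFintype_apply, lintegral_toMeasure_bind_map _ _ (fun s => by fun_prop) hg]
  rw [sampleLaw, Measure.lintegral_bind _ hf.aemeasurable]
  · simp_rw [key _ f hf]
  · refine (measurable_of_lintegral fun g hg => ?_).aemeasurable
    simp_rw [key _ g hg]
    refine Finset.measurable_sum _ fun a _ => measurable_const.mul ?_
    refine measurable_sum_mul_lintegral (fun s => ?_) _ fun s => hg.comp (by fun_prop)
    exact (Measurable.of_discrete (f := fun t : S => B.latent.T h t a s)).comp (by fun_prop)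

theorem isProbabilityMeasure_sampleLaw (B : BlockMDP S A X H) {π : Policy X A}
    (hπ : ∀ k, Measurable (π k)) (h : ℕ) : IsProbabilityMeasure (B.sampleLaw π h) := by
  have := B.isProbabilityMeasure_trajLaw hπ (h + 1)
  constructor
  have := B.lintegral_sampleLaw π h (f := fun _ => 1) measurable_const
  simpa [PMF.sum_eq_one, ENNReal.mul_inv_cancel] using this

end BlockMDP
end Episodes

/-! ### Hellinger distance and the Bhattacharyya coefficient. -/

section Affinity

variable {A : Type*} [Fintype A]

/-- The squared Hellinger distance is a sum of nonnegative terms, so two actions alone suffice to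
push the affinity below `1`. -/
theorem sum_sqrt_mul_eq {p q : A → ℝ} (hp : ∀ a, 0 ≤ p a) (hq : ∀ a, 0 ≤ q a)
    (hp1 : ∑ a, p a = 1) (hq1 : ∑ a, q a = 1) :
    ∑ a, √(p a * q a) = 1 - (∑ a, (√(p a) - √(q a)) ^ 2) / 2 := by
  have : ∀ a, √(p a * q a) = (p a + q a - (√(p a) - √(q a)) ^ 2) / 2 := fun a => by
    rw [Real.sqrt_mul (hp a)]
    linear_combination (1 / 2) * Real.sq_sqrt (hp a) + (1 / 2) * Real.sq_sqrt (hq a)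
  simp_rw [this]
  rw [← Finset.sum_div, Finset.sum_sub_distrib, Finset.sum_add_distrib, hp1, hq1]
  ring

/-- With `u = √(1 - η)` and `v = √η`, one has `1 - 2 * η = (u - v) * (u + v)`, and `(u + v) ^ 2 ≤ 2`
because `u ^ 2 + v ^ 2 = 1`. -/
theorem sqrt_sub_sqrt_sq_ge {η P Q : ℝ} (hη : 0 ≤ η) (hη2 : η < 1 / 2) (hP : 1 - η ≤ P)
    (hQ : Q ≤ η) : (1 - 2 * η) ^ 2 / 2 ≤ (√P - √Q) ^ 2 := by
  have h1 : √(1 - η) ≤ √P := Real.sqrt_le_sqrt hP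
  have h2 : √Q ≤ √η := Real.sqrt_le_sqrt hQ
  have h3 : √η ≤ √(1 - η) := Real.sqrt_le_sqrt (by linarith)
  have h4 : (√(1 - η) - √η) ^ 2 ≤ (√P - √Q) ^ 2 :=
    pow_le_pow_left₀ (by linarith) (by linarith) 2
  refine le_trans ?_ h4
  have e1 := Real.sq_sqrt hη
  have e2 := Real.sq_sqrt (show 0 ≤ 1 - η by linarith)
  set u := √(1 - η)
  set v := √η
  have e3 : (1 - 2 * η) = (u - v) * (u + v) := by linear_combination e1 - e2
  rw [e3, mul_pow]
  have h5 : (u + v) ^ 2 ≤ 2 := by nlinarith [sq_nonneg (u - v)]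
  nlinarith [sq_nonneg (u - v)]

/-- If the posterior `T / ∑ T` separates `g` from `b` by the margin `1 - η` against `η`, while `q`
prefers `b` to `g`, then the Bhattacharyya coefficient of the two is bounded away from `1`. -/
theorem sum_sqrt_add_le_one {T q : A → ℝ} {η : ℝ} (hη : 0 ≤ η) (hη2 : η < 1 / 2)
    (hT : ∀ a, 0 ≤ T a) (hT1 : ∀ a, T a ≤ 1) (hq : ∀ a, 0 ≤ q a) (hq1 : ∑ a, q a = 1) {g b : A}
    (hg : 1 - η ≤ T g) (hb : T b ≤ η) (hgb : q g ≤ q b) :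
    ∑ a, √(T a / (∑ a', T a') * q a) + (1 - 2 * η) ^ 2 / (4 * (Fintype.card A : ℝ) ^ 2) ≤ 1 := by
  classical
  set Z := ∑ a, T a with hZ
  have hne : g ≠ b := by rintro rfl; linarith
  have hZ0 : 0 < Z := lt_of_lt_of_le (by linarith)
    (hg.trans (Finset.single_le_sum (fun a _ => hT a) (Finset.mem_univ g)))
  have hZA : Z ≤ Fintype.card A := by
    simpa using Finset.sum_le_card_nsmul Finset.univ T 1 fun a _ => hT1 a
  have hA : (2 : ℝ) ≤ Fintype.card A := by
    exact_mod_cast Fintype.one_lt_card_iff.2 ⟨g, b, hne⟩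
  rw [sum_sqrt_mul_eq (p := fun a => T a / Z) (fun a => div_nonneg (hT a) hZ0.le) hq
    (by rw [← Finset.sum_div, div_self hZ0.ne']) hq1]
  have h1 : (√(T g / Z) - √(q g)) ^ 2 + (√(T b / Z) - √(q b)) ^ 2 ≤
      ∑ a, (√(T a / Z) - √(q a)) ^ 2 := by
    rw [← Finset.sum_pair (f := fun a => (√(T a / Z) - √(q a)) ^ 2) hne]
    exact Finset.sum_le_sum_of_subset_of_nonneg (Finset.subset_univ _) fun _ _ _ => sq_nonneg _
  have h2 : √(q g) ≤ √(q b) := Real.sqrt_le_sqrt hgb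
  have h3 : √(T b / Z) ≤ √(T g / Z) := Real.sqrt_le_sqrt (by gcongr; linarith)
  -- The posterior orders `g` above `b` and `q` orders them the other way, so the two gaps add up to
  -- at least the posterior gap; half the square of a sum bounds the sum of squares from below.
  have h4 : (√(T g / Z) - √(T b / Z)) ^ 2 / 2 ≤
      (√(T g / Z) - √(q g)) ^ 2 + (√(T b / Z) - √(q b)) ^ 2 := by
    nlinarith [mul_nonneg (sub_nonneg.2 h2) (sub_nonneg.2 h3), sq_nonneg (√(q b) - √(q g)),
      sq_nonneg (√(T g / Z) - √(q g) + (√(T b / Z) - √(q b)))]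
  have h5 : (1 - 2 * η) ^ 2 / 2 / Z ≤ (√(T g / Z) - √(T b / Z)) ^ 2 := by
    rw [Real.sqrt_div (hT g), Real.sqrt_div (hT b), ← sub_div, div_pow, Real.sq_sqrt hZ0.le]
    gcongr
    exact sqrt_sub_sqrt_sq_ge hη hη2 hg hb
  -- The argument yields the gap `(1 - 2 * η) ^ 2 / (8 * Z)`. It is weakened using `Z ≤ |A|` and `2
  -- ≤ |A|`.
  have h6 : (1 - 2 * η) ^ 2 / (4 * (Fintype.card A : ℝ) ^ 2) ≤ (1 - 2 * η) ^ 2 / 2 / Z / 4 := by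
    rw [div_div, div_div]
    apply div_le_div_of_nonneg_left (sq_nonneg _) (by positivity)
    nlinarith
  linarith

/-- Turns a `p`-average of square-root likelihood ratios into an affinity. Terms with `p = 0` vanish
because `0 * ∞ = 0`. -/
theorem mul_div_rpow_half_le {p q : ℝ≥0∞} (hp : p ≠ ∞) (hq : q ≠ ∞) :
    p * (q / p) ^ (1 / 2 : ℝ) ≤ ENNReal.ofReal √(p.toReal * q.toReal) := by
  rcases eq_or_ne p 0 with rfl | h0
  · simp
  lift p to NNReal using hp
  lift q to NNReal using hq
  have h0' : p ≠ 0 := by simpa using h0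
  rw [← ENNReal.coe_div h0', ← ENNReal.coe_rpow_of_nonneg _ (by norm_num), ← NNReal.sqrt_eq_rpow,
    ← ENNReal.coe_mul, ENNReal.coe_toReal, ENNReal.coe_toReal, ← NNReal.coe_mul,
    ← Real.coe_sqrt, ENNReal.ofReal_coe_nnreal, ENNReal.coe_le_coe]
  refine le_of_eq ?_
  rw [NNReal.sqrt_div, NNReal.sqrt_mul]
  have : NNReal.sqrt p ≠ 0 := by simpa using h0'
  field_simp
  rw [mul_comm, NNReal.sq_sqrt]

theorem sum_mul_div_rpow_half_add_le (p q : PMF A) {c : ℝ} (hc : 0 ≤ c)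
    (h : ∑ a, √((p a).toReal * (q a).toReal) + c ≤ 1) :
    ∑ a, p a * ((q a / p a) ^ (1 / 2 : ℝ) + ENNReal.ofReal c) ≤ 1 := by
  simp_rw [mul_add, Finset.sum_add_distrib, ← Finset.sum_mul, p.sum_eq_one, one_mul]
  calc _ ≤ ∑ a, ENNReal.ofReal √((p a).toReal * (q a).toReal) + ENNReal.ofReal c := by
        gcongr with a
        exact mul_div_rpow_half_le (p.apply_ne_top a) (q.apply_ne_top a)
    _ = ENNReal.ofReal (∑ a, √((p a).toReal * (q a).toReal) + c) := by
        rw [ENNReal.ofReal_add (by positivity) hc, ENNReal.ofReal_sum_of_nonneg fun _ _ => by positivity]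
    _ ≤ 1 := by simpa using ENNReal.ofReal_le_ofReal h

end Affinity

/-! ### Episodes visit only reachable states. -/

section Reachability

variable {S A X : Type*} [Fintype S] [MeasurableSpace S] [MeasurableSingletonClass S]
  [Fintype A] [MeasurableSpace A] [MeasurableSingletonClass A] [MeasurableSpace X] {H : ℕ}

namespace BlockMDP

theorem ae_trajLaw_succ (B : BlockMDP S A X H) {π : Policy X A} (hπ : ∀ k, Measurable (π k))
    {h : ℕ} {R : S → Prop} (hR : ∀ᵐ τ ∂(B.trajLaw π h), ∀ s, B.nextState π h τ s ≠ 0 → R s)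
    {P : S → X → Prop} (hP : ∀ s, R s → ∀ᵐ x ∂(B.emit s), P s x) :
    ∀ᵐ τ ∂(B.trajLaw π (h + 1)), R (τ (Fin.last h)).2 ∧ P (τ (Fin.last h)).2 (τ (Fin.last h)).1 := by
  classical
  -- `P` need not be measurable, so its exceptional sets are replaced by measurable hulls. Taking
  -- everything when `R` fails makes avoiding `N` imply both `R` and `P`.
  let N : S → Set X := fun s => if R s then toMeasurable (B.emit s) {x | ¬ P s x} else Set.univ
  have hN : ∀ s, MeasurableSet (N s) := fun s => by
    simp only [N]; split_ifs
    · exact measurableSet_toMeasurable _ _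
    · exact MeasurableSet.univ
  have hN0 : ∀ s, R s → B.emit s (N s) = 0 := fun s hs => by
    simp only [N, if_pos hs, measure_toMeasurable]; exact hP s hs
  let g : X × S → ℝ≥0∞ := fun y => (N y.2).indicator 1 y.1
  have hg : Measurable g := measurable_from_prod_countable_left fun s =>
    measurable_one.indicator (hN s)
  have hg' : Measurable fun τ : Fin (h + 1) → X × S => g (τ (Fin.last h)) :=
    hg.comp (measurable_pi_apply _)
  have h0 : ∫⁻ τ, g (τ (Fin.last h)) ∂(B.trajLaw π (h + 1)) = 0 := by
    rw [B.lintegral_trajLaw_succ hπ h hg', lintegral_eq_zero_of_ae_eq_zero]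
    filter_upwards [hR] with τ hτ
    refine Finset.sum_eq_zero fun s _ => ?_
    by_cases hs : B.nextState π h τ s = 0
    · simp [hs]
    · simp [g, lintegral_indicator_one (hN s), hN0 s (hτ s hs)]
  rw [lintegral_eq_zero_iff hg'] at h0
  filter_upwards [h0] with τ hτ
  have hτ' : (τ (Fin.last h)).1 ∉ N (τ (Fin.last h)).2 := by
    intro hmem
    simp [g, hmem] at hτ
  have hRτ : R (τ (Fin.last h)).2 := by
    by_contra hn
    exact hτ' (by simp [N, hn])
  refine ⟨hRτ, ?_⟩
  by_contra hn
  exact hτ' (by simp only [N, if_pos hRτ]; exact subset_toMeasurable _ _ hn)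

/-- Realizability describes the posterior only at reachable states; this lets it be used along
almost every episode. -/
theorem ae_trajLaw_last (B : BlockMDP S A X H) {π : Policy X A} (hπ : ∀ k, Measurable (π k))
    {h : ℕ} {P : S → X → Prop}
    (hP : ∀ s, B.latent.Reachable h s → ∀ᵐ x ∂(B.emit s), P s x) :
    ∀ᵐ τ ∂(B.trajLaw π (h + 1)),
      B.latent.Reachable h (τ (Fin.last h)).2 ∧ P (τ (Fin.last h)).2 (τ (Fin.last h)).1 := by
  induction h generalizing P with
  | zero => exact B.ae_trajLaw_succ hπ (Filter.Eventually.of_forall fun τ s hs => hs) hP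
  | succ h ih =>
    refine B.ae_trajLaw_succ hπ ?_ hP
    filter_upwards [ih (P := fun _ _ => True) (by simp)] with τ hτ s hs
    exact ⟨_, _, hτ.1, hs⟩

/-- An integral against the law of the recorded triples is bounded by integrating the action out
first. -/
theorem lintegral_sampleLaw_le [Nonempty A] (B : BlockMDP S A X H) {π : Policy X A}
    (hπ : ∀ k, Measurable (π k)) {h : ℕ} {g : X × A × X → ℝ≥0∞} (hg : Measurable g) {K : ℝ≥0∞}
    (hK : ∀ s, B.latent.Reachable h s → ∀ᵐ x ∂(B.emit s), ∀ s', ∀ᵐ x' ∂(B.emit s'),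
      ∑ a, B.latent.T h s a s' * g (x, a, x') ≤ K * ∑ a, B.latent.T h s a s') :
    ∫⁻ y, g y ∂(B.sampleLaw π h) ≤ K := by
  have := B.isProbabilityMeasure_trajLaw hπ (h + 1)
  rw [B.lintegral_sampleLaw π h hg]
  refine (lintegral_mono_ae (g := fun _ => K) ?_).trans (by simp)
  filter_upwards [B.ae_trajLaw_last hπ hK] with τ hτ
  obtain ⟨-, hτ⟩ := hτ
  set s := (τ (Fin.last h)).2
  set x := (τ (Fin.last h)).1
  rw [← Finset.mul_sum, Finset.sum_comm]
  have hm : ∀ a, Measurable fun x' => g (x, a, x') := fun a => by fun_prop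
  calc _ ≤ (Fintype.card A : ℝ≥0∞)⁻¹ * ∑ s', K * ∑ a, B.latent.T h s a s' := by
        gcongr with s'
        simp_rw [← lintegral_const_mul _ (hm _)]
        rw [← lintegral_finsetSum _ fun a _ => (hm a).const_mul _]
        exact (lintegral_mono_ae (hτ s')).trans (by simp)
    _ = K := by
        rw [← Finset.mul_sum, Finset.sum_comm]
        simp only [PMF.sum_eq_one, Finset.sum_const, Finset.card_univ, nsmul_eq_mul, mul_one]
        rw [mul_comm K, ← mul_assoc, ENNReal.inv_mul_cancel (by simp) (by simp), one_mul]

end BlockMDP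
end Reachability

/-! ### Deterministic transitions and their perturbations. -/

namespace MDP
variable {S A : Type*} {H : ℕ}

theorem next_eq_iff (M : MDP S A H) (hdet : M.Deterministic) {h : ℕ} (hh : h < H) (s : S) (a : A)
    (s' : S) : M.next h s a = s' ↔ M.T h s a s' = 1 := by
  classical
  have huniq : ∀ t t', M.T h s a t = 1 → M.T h s a t' = 1 → t = t' := by
    intro t t' ht ht'
    have := (PMF.apply_eq_one_iff _ _).1 ht
    have h2 : t' ∈ (M.T h s a).support := by simp [PMF.mem_support_iff, ht']
    rw [this] at h2
    exact h2.symm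
  have hex : ∃ t, M.T h s a t = 1 := by
    obtain ⟨t, ht⟩ := (M.T h s a).support_nonempty
    exact ⟨t, (hdet h hh s a t).resolve_left ht⟩
  rw [next, dif_pos hex]
  exact ⟨fun h => h ▸ hex.choose_spec, fun h => huniq _ _ hex.choose_spec h⟩

theorem exists_next_eq [Fintype A] {M M' : MDP S A H} {η : ℝ} (hdet : M.Deterministic)
    (hpert : IsPerturbation η M M') {h : ℕ} (hh : h < H) {s s' : S} {a : A}
    (ha : M'.T h s a s' ≠ 0) : ∃ g, M.next h s g = s' := by
  obtain ⟨ξ, hξ, hT, hR⟩ := hpert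
  rw [hT h hh] at ha
  obtain ⟨g, -, hg⟩ := Finset.exists_ne_zero_of_sum_ne_zero ha
  exact ⟨g, (M.next_eq_iff hdet hh s g s').2
    ((hdet h hh s g s').resolve_left (left_ne_zero_of_mul hg))⟩

theorem le_of_next_eq [Fintype A] {M M' : MDP S A H} {η : ℝ} (hdet : M.Deterministic)
    (hpert : IsPerturbation η M M') {h : ℕ} (hh : h < H) {s s' : S} {a : A}
    (ha : M.next h s a = s') : 1 - η ≤ (M'.T h s a s').toReal := by
  obtain ⟨ξ, hξ, hT, hR⟩ := hpert
  refine (hξ h hh s a).trans (ENNReal.toReal_mono (PMF.apply_ne_top _ _) ?_)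
  rw [hT h hh]
  refine le_trans ?_ (Finset.single_le_sum (fun _ _ => zero_le) (Finset.mem_univ a))
  rw [(M.next_eq_iff hdet hh s a s').1 ha, one_mul]

/-- The simulated successor already takes mass `1 - η`, leaving at most `η` for any other state. -/
theorem le_of_next_ne [Fintype A] {M M' : MDP S A H} {η : ℝ} (hdet : M.Deterministic)
    (hpert : IsPerturbation η M M') {h : ℕ} (hh : h < H) {s s' : S} {a : A}
    (ha : M.next h s a ≠ s') : (M'.T h s a s').toReal ≤ η := by
  classical
  have h1 := le_of_next_eq hdet hpert hh (rfl : M.next h s a = _)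
  have h2 : M'.T h s a s' + M'.T h s a (M.next h s a) ≤ 1 := by
    rw [← (M'.T h s a).tsum_coe, ← Finset.sum_pair ha.symm]
    exact ENNReal.sum_le_tsum _
  have h3 := ENNReal.toReal_mono ENNReal.one_ne_top h2
  rw [ENNReal.toReal_add (PMF.apply_ne_top _ _) (PMF.apply_ne_top _ _)] at h3
  simp only [ENNReal.toReal_one] at h3
  linarith

end MDP

/-! ### One dataset: posterior, likelihood ratio and decoding error. -/

section

/-- The gap in Bhattacharyya affinity caused by a decoding error, for `k` actions. -/
noncomputable def affinityGap (η : ℝ) (k : ℕ) : ℝ := (1 - 2 * η) ^ 2 / (4 * (k : ℝ) ^ 2)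

theorem affinityGap_nonneg (η : ℝ) (k : ℕ) : 0 ≤ affinityGap η k := by
  unfold affinityGap; positivity

/-- The triples whose observations are mapped by `α` to an action that does not explain the
latent transition in the simulator `M`. -/
def shadowError {S A X : Type*} [MeasurableSpace S] [MeasurableSpace X] {H : ℕ} (M : MDP S A H)
    (B : BlockMDP S A X H) (h : ℕ) (α : X → X → A) : Set (X × A × X) :=
  {y | M.next h (B.decoder y.1) (α y.1 y.2.2) ≠ B.decoder y.2.2}

/-- `f` is the inverse-dynamics posterior at step `h`. -/
def IsPosterior {S A X : Type*} [MeasurableSpace S] [MeasurableSpace X] {H : ℕ} [Fintype A]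
    (B : BlockMDP S A X H) (h : ℕ) (f : X → X → PMF A) : Prop :=
  ∀ s s', B.latent.Reachable h s → (∃ a, B.latent.T h s a s' ≠ 0) →
    ∀ᵐ x ∂(B.emit s), ∀ᵐ x' ∂(B.emit s'), ∀ a,
      f x x' a = B.latent.T h s a s' / ∑ a', B.latent.T h s a' s'

variable {S A X : Type*} [Fintype S] [MeasurableSpace S] [MeasurableSingletonClass S]
  [Fintype A] [Nonempty A] [MeasurableSpace A] [MeasurableSingletonClass A]
  [MeasurableSpace X] {H : ℕ}

theorem measurableSet_ne_of_discrete {Ω T : Type*} [MeasurableSpace Ω] [MeasurableSpace T]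
    [Countable T] [MeasurableSingletonClass T] {f g : Ω → T} (hf : Measurable f)
    (hg : Measurable g) : MeasurableSet {ω | f ω ≠ g ω} :=
  (hf.prodMk hg) (MeasurableSet.of_discrete (s := {q : T × T | q.1 ≠ q.2}))

theorem measurable_next (M : MDP S A H) (h : ℕ) {Ω : Type*} [MeasurableSpace Ω] {f : Ω → S}
    {g : Ω → A} (hf : Measurable f) (hg : Measurable g) :
    Measurable fun ω => M.next h (f ω) (g ω) :=
  (Measurable.of_discrete (f := fun q : S × A => M.next h q.1 q.2)).comp (hf.prodMk hg)

theorem measurableSet_shadowError (M : MDP S A H) (B : BlockMDP S A X H) (h : ℕ) {α : X → X → A}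
    (hα : Measurable fun p : X × X => α p.1 p.2) : MeasurableSet (shadowError M B h α) := by
  have hd := B.measurable_decoder
  exact measurableSet_ne_of_discrete
    (measurable_next M h (by fun_prop) (hα.comp (measurable_fst.prodMk measurable_snd.snd)))
    (by fun_prop)

theorem measurable_eval_action {f : X → X → PMF A}
    (hf : ∀ a, Measurable fun p : X × X => f p.1 p.2 a) :
    Measurable fun y : X × A × X => f y.1 y.2.2 y.2.1 := by
  have : Measurable fun q : (X × X) × A => f q.1.1 q.1.2 q.2 :=
    measurable_from_prod_countable_left hf
  exact this.comp (f := fun y : X × A × X => ((y.1, y.2.2), y.2.1)) (by fun_prop)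

namespace IsPosterior

variable {B : BlockMDP S A X H} {h : ℕ} {fs : X → X → PMF A}

/-- Bounds on `fs`-averages transfer to the law of the recorded triples. -/
theorem lintegral_sampleLaw_le (hfs : IsPosterior B h fs) {π : Policy X A}
    (hπ : ∀ k, Measurable (π k)) {g : X × A × X → ℝ≥0∞} (hg : Measurable g) {K : ℝ≥0∞}
    (hK : ∀ s x s' x', B.decoder x = s → B.decoder x' = s' → (∃ a, B.latent.T h s a s' ≠ 0) →
      (∀ a, fs x x' a = B.latent.T h s a s' / ∑ a', B.latent.T h s a' s') →
      ∑ a, fs x x' a * g (x, a, x') ≤ K) :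
    ∫⁻ y, g y ∂(B.sampleLaw π h) ≤ K := by
  refine B.lintegral_sampleLaw_le hπ hg fun s hs => ?_
  have hae : ∀ᵐ x ∂(B.emit s), ∀ s', (∃ a, B.latent.T h s a s' ≠ 0) → ∀ᵐ x' ∂(B.emit s'), ∀ a,
      fs x x' a = B.latent.T h s a s' / ∑ a', B.latent.T h s a' s' := by
    rw [ae_all_iff]
    intro s'
    by_cases hex : ∃ a, B.latent.T h s a s' ≠ 0
    · filter_upwards [hfs s s' hs hex] with x hx _ using hx
    · exact Filter.Eventually.of_forall fun x hx => absurd hx hex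
  filter_upwards [B.decoder_emit s, hae] with x hx hxs s'
  by_cases hex : ∃ a, B.latent.T h s a s' ≠ 0
  · filter_upwards [B.decoder_emit s', hxs s' hex] with x' hx' hf
    set Z := ∑ a, B.latent.T h s a s' with hZ
    have hZ0 : Z ≠ 0 := by
      obtain ⟨a, ha⟩ := hex
      intro h0
      exact ha (Finset.sum_eq_zero_iff.1 h0 a (Finset.mem_univ a))
    have hZt : Z ≠ ∞ := ENNReal.sum_ne_top.2 fun a _ => PMF.apply_ne_top _ _
    -- Bayes' rule for uniform actions: the transition weights are the posterior times a normalizer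
    -- that does not depend on the action, so the posterior average factors out.
    have hT : ∀ a, B.latent.T h s a s' = Z * fs x x' a := fun a => by
      rw [hf, ENNReal.mul_div_cancel hZ0 hZt]
    have := hK s x s' x' hx hx' hex hf
    calc _ = Z * ∑ a, fs x x' a * g (x, a, x') := by
          rw [Finset.mul_sum]
          exact Finset.sum_congr rfl fun a _ => by rw [hT a, mul_assoc]
      _ ≤ Z * K := by gcongr
      _ = _ := mul_comm _ _
  · push Not at hex
    simp [hex]

/-- An action drawn from its posterior almost never has posterior mass `0`. This matters because `0
/ 0 = 0` would spoil the likelihood ratio. -/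
theorem sampleLaw_eq_zero (hfs : IsPosterior B h fs)
    (hm : ∀ a, Measurable fun p : X × X => fs p.1 p.2 a) {π : Policy X A}
    (hπ : ∀ k, Measurable (π k)) : ∀ᵐ y ∂(B.sampleLaw π h), fs y.1 y.2.2 y.2.1 ≠ 0 := by
  classical
  have hE : MeasurableSet {y : X × A × X | fs y.1 y.2.2 y.2.1 = 0} :=
    measurable_eval_action hm (measurableSet_singleton 0)
  have := hfs.lintegral_sampleLaw_le hπ (measurable_one.indicator hE) (K := 0)
    fun s x s' x' _ _ _ _ => by simp [Set.indicator_apply]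
  rw [lintegral_indicator_one hE, nonpos_iff_eq_zero] at this
  simpa [ae_iff] using this

/-- Whether an error occurs depends on `x, x'` and not on the recorded action. The bound can thus be
checked for fixed observations: affinity at most `1` without an error, and at most `1` minus the gap
with one. -/
theorem lintegral_ratio_add_le (hfs : IsPosterior B h fs)
    (hm : ∀ a, Measurable fun p : X × X => fs p.1 p.2 a) {M : MDP S A H}
    (hdet : M.Deterministic) {η : ℝ} (hη : η < 1 / 2) (hpert : MDP.IsPerturbation η M B.latent)
    (hh : h < H) {π : Policy X A} (hπ : ∀ k, Measurable (π k)) {f : X → X → PMF A}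
    (hf : ∀ a, Measurable fun p : X × X => f p.1 p.2 a) {α : X → X → A}
    (hα : Measurable fun p : X × X => α p.1 p.2) (hmax : ∀ x x' a, f x x' a ≤ f x x' (α x x')) :
    ∫⁻ y, (f y.1 y.2.2 y.2.1 / fs y.1 y.2.2 y.2.1) ^ (1 / 2 : ℝ) ∂(B.sampleLaw π h) +
      ENNReal.ofReal (affinityGap η (Fintype.card A)) *
        B.sampleLaw π h (shadowError M B h α) ≤ 1 := by
  classical
  set c := affinityGap η (Fintype.card A) with hc
  have hE := measurableSet_shadowError M B h hα
  have hr : Measurable fun y : X × A × X =>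
      (f y.1 y.2.2 y.2.1 / fs y.1 y.2.2 y.2.1) ^ (1 / 2 : ℝ) :=
    ((measurable_eval_action hf).div (measurable_eval_action hm)).pow_const _
  rw [← lintegral_indicator_const hE, ← lintegral_add_left hr]
  refine hfs.lintegral_sampleLaw_le hπ
    (hr.add ((measurable_const (a := ENNReal.ofReal c)).indicator hE)) ?_
  intro s x s' x' hx hx' hex hp
  by_cases herr : M.next h s (α x x') = s'
  · have hmem : ∀ a, (x, a, x') ∉ shadowError M B h α := fun a => by
      simp [shadowError, hx, hx', herr]
    have := sum_mul_div_rpow_half_add_le (fs x x') (f x x') le_rfl (by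
      rw [sum_sqrt_mul_eq (fun _ => ENNReal.toReal_nonneg) (fun _ => ENNReal.toReal_nonneg)
        (fs x x').sum_toReal (f x x').sum_toReal]
      have : 0 ≤ ∑ a, (√(fs x x' a).toReal - √(f x x' a).toReal) ^ 2 :=
        Finset.sum_nonneg fun _ _ => sq_nonneg _
      linarith)
    simpa [hmem] using this
  · have hmem : ∀ a, (x, a, x') ∈ shadowError M B h α := fun a => by
      simp [shadowError, hx, hx', herr]
    obtain ⟨a, ha⟩ := hex
    -- A transition possible in the target is explained by some action of the simulator; this is the
    -- competitor of the wrongly chosen action.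
    obtain ⟨g, hg⟩ := MDP.exists_next_eq hdet hpert hh ha
    have hb := MDP.le_of_next_ne hdet hpert hh herr
    have hη0 : 0 ≤ η := ENNReal.toReal_nonneg.trans hb
    have := sum_mul_div_rpow_half_add_le (fs x x') (f x x') (affinityGap_nonneg η _) (by
      have := sum_sqrt_add_le_one (T := fun a => (B.latent.T h s a s').toReal) hη0 hη
        (fun _ => ENNReal.toReal_nonneg) (fun a => PMF.toReal_le_one _ _)
        (fun _ => ENNReal.toReal_nonneg) (f x x').sum_toReal
        (MDP.le_of_next_eq hdet hpert hh hg) hb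
        (ENNReal.toReal_mono (PMF.apply_ne_top _ _) (hmax x x' g))
      simp only [hp, ENNReal.toReal_div]
      rw [ENNReal.toReal_sum fun a _ => PMF.apply_ne_top _ _]
      exact this)
    simpa [hmem] using this

end IsPosterior

end

/-! ### Comparing two policies through the event that they agree. -/

section

variable {S A X : Type*} [Fintype S] [MeasurableSpace S] [MeasurableSingletonClass S]
  [Fintype A] [Nonempty A] [MeasurableSpace A] [MeasurableSingletonClass A]
  [MeasurableSpace X] {H : ℕ}

/-- The observations up to step `k` of a trajectory of length `h > k`. -/
def obsUpTo {h : ℕ} (τ : Fin h → X × S) (k : Fin h) : Fin (k + 1) → X :=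
  fun i => (τ ⟨i, lt_of_lt_of_le i.isLt k.isLt⟩).1

theorem measurable_obsUpTo {h : ℕ} (k : Fin h) :
    Measurable fun τ : Fin h → X × S => obsUpTo τ k := by
  unfold obsUpTo; fun_prop

theorem obsUpTo_last {h : ℕ} (τ : Fin (h + 1) → X × S) :
    obsUpTo τ (Fin.last h) = fun i => (τ i).1 := rfl

theorem obsUpTo_snoc_castSucc {h : ℕ} (τ : Fin h → X × S) (y : X × S) (k : Fin h) :
    obsUpTo (Fin.snoc (α := fun _ => X × S) τ y) k.castSucc = obsUpTo τ k := by
  funext i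
  have hi : (i : ℕ) < h := lt_of_lt_of_le i.isLt k.isLt
  exact congrArg Prod.fst (Fin.snoc_castSucc (α := fun _ => X × S) y τ ⟨i, hi⟩)

/-- The trajectories along which two policies choose the same actions. -/
def agreeSet (π π' : Policy X A) (h : ℕ) : Set (Fin h → X × S) :=
  {τ | ∀ k : Fin h, π k (obsUpTo τ k) = π' k (obsUpTo τ k)}

theorem measurableSet_agreeSet {π π' : Policy X A} (hπ : ∀ k, Measurable (π k))
    (hπ' : ∀ k, Measurable (π' k)) (h : ℕ) :
    MeasurableSet (agreeSet π π' h : Set (Fin h → X × S)) := by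
  rw [agreeSet, Set.ofPred_forall]
  refine MeasurableSet.iInter fun k => ?_
  have := (measurableSet_ne_of_discrete ((hπ k).comp (measurable_obsUpTo (S := S) k))
    ((hπ' k).comp (measurable_obsUpTo k))).compl
  simpa [Set.compl_ofPred] using this

theorem mem_agreeSet_of_snoc {π π' : Policy X A} {h : ℕ} {τ : Fin h → X × S} {y : X × S}
    (hτ : Fin.snoc (α := fun _ => X × S) τ y ∈ agreeSet π π' (h + 1)) : τ ∈ agreeSet π π' h := by
  intro k
  have := hτ k.castSucc
  rwa [obsUpTo_snoc_castSucc] at this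

namespace BlockMDP

theorem nextState_eq_of_mem_agreeSet (B : BlockMDP S A X H) {π π' : Policy X A} {h : ℕ}
    {τ : Fin h → X × S} (hτ : τ ∈ agreeSet π π' h) : B.nextState π h τ = B.nextState π' h τ := by
  cases h with
  | zero => rfl
  | succ k =>
    have := hτ (Fin.last k)
    rw [obsUpTo_last] at this
    simp only [nextState]
    exact congrArg _ this

/-- Agreement on a trajectory passes to its prefix. The inner integral therefore vanishes off the
shorter agreement set, and on that set both policies give the same next-state law. -/
theorem lintegral_agreeSet (B : BlockMDP S A X H) {π π' : Policy X A}
    (hπ : ∀ k, Measurable (π k)) (hπ' : ∀ k, Measurable (π' k)) (h : ℕ)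
    {f : (Fin h → X × S) → ℝ≥0∞} (hf : Measurable f) :
    ∫⁻ τ in agreeSet π π' h, f τ ∂(B.trajLaw π h) =
      ∫⁻ τ in agreeSet π π' h, f τ ∂(B.trajLaw π' h) := by
  have hE := fun h => measurableSet_agreeSet (S := S) hπ hπ' h
  induction h with
  | zero => rfl
  | succ h ih =>
    have hf' := hf.indicator (hE (h + 1))
    rw [← lintegral_indicator (hE _), ← lintegral_indicator (hE _),
      B.lintegral_trajLaw_succ hπ h hf', B.lintegral_trajLaw_succ hπ' h hf']
    set G : Policy X A → (Fin h → X × S) → ℝ≥0∞ := fun π₁ τ => ∑ s, B.nextState π₁ h τ s *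
      ∫⁻ x, (agreeSet π π' (h + 1)).indicator f (Fin.snoc (α := fun _ => X × S) τ (x, s))
        ∂(B.emit s) with hG
    have hind : ∀ π₁, G π₁ = (agreeSet π π' h).indicator (G π₁) := by
      intro π₁
      refine (Set.indicator_eq_self.2 fun τ hτ => ?_).symm
      by_contra hn
      refine hτ (Finset.sum_eq_zero fun s _ => ?_)
      have : ∀ x, (agreeSet π π' (h + 1)).indicator f
          (Fin.snoc (α := fun _ => X × S) τ (x, s)) = 0 := fun x =>
        Set.indicator_of_notMem (fun hm => hn (mem_agreeSet_of_snoc hm)) _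
      simp [this]
    have hmeas : Measurable (G π') :=
      measurable_sum_mul_lintegral (fun s => B.measurable_nextState hπ' h s) _
        fun s => hf'.comp (measurable_snoc_pair h s)
    change ∫⁻ τ, G π τ ∂_ = ∫⁻ τ, G π' τ ∂_
    have heq : G π = (agreeSet π π' h).indicator (G π') := by
      rw [hind π]
      refine Set.indicator_congr fun τ hτ => ?_
      simp only [hG, B.nextState_eq_of_mem_agreeSet hτ]
    rw [heq, lintegral_indicator (hE h), ih hmeas, ← lintegral_indicator (hE h), ← hind]

theorem restrict_agreeSet (B : BlockMDP S A X H) {π π' : Policy X A}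
    (hπ : ∀ k, Measurable (π k)) (hπ' : ∀ k, Measurable (π' k)) (h : ℕ) :
    (B.trajLaw π h).restrict (agreeSet π π' h) = (B.trajLaw π' h).restrict (agreeSet π π' h) :=
  Measure.ext_of_lintegral _ fun _ hf => B.lintegral_agreeSet hπ hπ' h hf

theorem totalReward_mem (B : BlockMDP S A X H) (π : Policy X A) (τ : Fin H → X × S) :
    B.totalReward π τ ∈ Set.Icc (0 : ℝ) H := by
  have := fun k : Fin H => B.latent.R_mem k k.isLt (τ k).2
    (π k fun i => (τ ⟨i, lt_of_lt_of_le i.isLt k.isLt⟩).1)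
  refine ⟨Finset.sum_nonneg fun k _ => (this k).1, ?_⟩
  simpa [totalReward] using Finset.sum_le_card_nsmul Finset.univ _ (1 : ℝ) fun k _ => (this k).2

theorem integrable_totalReward (B : BlockMDP S A X H) {π : Policy X A}
    (hπ : ∀ k, Measurable (π k)) (μ : Measure (Fin H → X × S)) [IsFiniteMeasure μ] :
    Integrable (B.totalReward π) μ := by
  have hm : Measurable (B.totalReward π) := by
    refine Finset.measurable_sum _ fun k _ => ?_
    exact (Measurable.of_discrete (f := fun q : S × A => B.latent.R k q.1 q.2)).comp
      ((measurable_pi_apply k).snd.prodMk ((hπ k).comp (measurable_obsUpTo k)))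
  refine Integrable.of_bound hm.aestronglyMeasurable H (Filter.Eventually.of_forall fun τ => ?_)
  rw [Real.norm_of_nonneg (B.totalReward_mem π τ).1]
  exact (B.totalReward_mem π τ).2

theorem value_mem (B : BlockMDP S A X H) {π : Policy X A} (hπ : ∀ k, Measurable (π k)) :
    B.value π ∈ Set.Icc (0 : ℝ) H := by
  have := B.isProbabilityMeasure_trajLaw hπ H
  refine ⟨integral_nonneg fun τ => (B.totalReward_mem π τ).1, ?_⟩
  refine (integral_mono (B.integrable_totalReward hπ _) (integrable_const (H : ℝ))
    fun τ => (B.totalReward_mem π τ).2).trans (by simp)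

/-- The two laws coincide on the agreement event, so its complement is equally likely under both,
and there at most `H` is lost. The event is measured under `π`, the policy that collects the data.
-/
theorem value_sub_le (B : BlockMDP S A X H) {π π' : Policy X A}
    (hπ : ∀ k, Measurable (π k)) (hπ' : ∀ k, Measurable (π' k)) :
    B.value π' - H * (B.trajLaw π H (agreeSet π π' H)ᶜ).toReal ≤ B.value π := by
  have := B.isProbabilityMeasure_trajLaw hπ H
  have := B.isProbabilityMeasure_trajLaw hπ' H
  have hE := measurableSet_agreeSet (S := S) hπ hπ' H
  have hres := B.restrict_agreeSet hπ hπ' H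
  have hcompl : B.trajLaw π H (agreeSet π π' H)ᶜ = B.trajLaw π' H (agreeSet π π' H)ᶜ := by
    have := congrArg (fun μ => μ Set.univ) hres
    simp only [Measure.restrict_apply_univ] at this
    rw [prob_compl_eq_one_sub hE, prob_compl_eq_one_sub hE, this]
  have h1 : ∫ τ in agreeSet π π' H, B.totalReward π' τ ∂(B.trajLaw π' H) ≤ B.value π := by
    rw [← hres, value, setIntegral_congr_fun hE (g := B.totalReward π)]
    · exact setIntegral_le_integral (B.integrable_totalReward hπ _)
        (Filter.Eventually.of_forall fun τ => (B.totalReward_mem π τ).1)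
    · intro τ hτ
      refine Finset.sum_congr rfl fun k _ => ?_
      exact congrArg _ (hτ k).symm
  have h2 : ∫ τ in (agreeSet π π' H)ᶜ, B.totalReward π' τ ∂(B.trajLaw π' H) ≤
      H * (B.trajLaw π H (agreeSet π π' H)ᶜ).toReal := by
    rw [hcompl]
    refine (integral_mono (B.integrable_totalReward hπ' _) (integrable_const (H : ℝ))
      fun τ => (B.totalReward_mem π' τ).2).trans (le_of_eq ?_)
    simp [Measure.real, mul_comm]
  have h3 := integral_add_compl hE (B.integrable_totalReward hπ' (B.trajLaw π' H))
  change _ = B.value π' at h3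
  linarith

end BlockMDP

/-! ### Propagation of decoding errors -/

theorem measurable_stateDecoder (M : MDP S A H) (s₀ : S) {α : ℕ → X → X → A}
    (hα : ∀ k, Measurable fun p : X × X => α k p.1 p.2) (k : ℕ) :
    Measurable (stateDecoder M s₀ α k) := by
  induction k with
  | zero => exact measurable_const
  | succ k ih =>
    exact measurable_next M k (ih.comp (by fun_prop))
      ((hα k).comp (f := fun xs : Fin (k + 1 + 1) → X =>
        (xs (Fin.last k).castSucc, xs (Fin.last (k + 1)))) (by fun_prop))

/-- The trajectories on which the state decoder built from `α` agrees with the perfect decoder. -/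
def decodedSet (M : MDP S A H) (B : BlockMDP S A X H) (s₀ : S) (α : ℕ → X → X → A) (h : ℕ) :
    Set (Fin h → X × S) :=
  {τ | ∀ k : Fin h, stateDecoder M s₀ α k (obsUpTo τ k) = B.decoder (τ k).1}

/-- The event that the first decoding error can occur when the observation at step `h` arrives. -/
def stepError (M : MDP S A H) (B : BlockMDP S A X H) (s₀ : S) (α : ℕ → X → X → A) :
    (h : ℕ) → (Fin h → X × S) → X → Prop
  | 0, _, x => B.decoder x ≠ s₀
  | k + 1, τ, x => M.next k (B.decoder (τ (Fin.last k)).1) (α k (τ (Fin.last k)).1 x) ≠ B.decoder x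

theorem measurableSet_decodedSet (M : MDP S A H) (B : BlockMDP S A X H) (s₀ : S)
    {α : ℕ → X → X → A} (hα : ∀ k, Measurable fun p : X × X => α k p.1 p.2) (h : ℕ) :
    MeasurableSet (decodedSet M B s₀ α h) := by
  rw [decodedSet, Set.ofPred_forall]
  refine MeasurableSet.iInter fun k => ?_
  have := (measurableSet_ne_of_discrete
    ((measurable_stateDecoder M s₀ hα k).comp (measurable_obsUpTo (S := S) k))
    (B.measurable_decoder.comp (measurable_pi_apply k).fst)).compl
  simpa [Set.compl_ofPred] using this

theorem measurableSet_stepError (M : MDP S A H) (B : BlockMDP S A X H) (s₀ : S)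
    {α : ℕ → X → X → A} (hα : ∀ k, Measurable fun p : X × X => α k p.1 p.2) (h : ℕ) :
    MeasurableSet {q : (Fin h → X × S) × X | stepError M B s₀ α h q.1 q.2} := by
  have hd := B.measurable_decoder
  cases h with
  | zero => exact measurableSet_ne_of_discrete (by fun_prop) measurable_const
  | succ k =>
    exact measurableSet_ne_of_discrete (measurable_next M k (by fun_prop)
      ((hα k).comp (f := fun q : (Fin (k + 1) → X × S) × X => ((q.1 (Fin.last k)).1, q.2))
        (by fun_prop))) (by fun_prop)

/-- From a correct simulated state, an action that explains the latent transition leads to the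
correct next state, even if it is not the action played. -/
theorem snoc_mem_decodedSet {M : MDP S A H} {B : BlockMDP S A X H} {s₀ : S}
    {α : ℕ → X → X → A} {h : ℕ} {τ : Fin h → X × S} {y : X × S}
    (hτ : τ ∈ decodedSet M B s₀ α h) (hy : ¬ stepError M B s₀ α h τ y.1) :
    Fin.snoc (α := fun _ => X × S) τ y ∈ decodedSet M B s₀ α (h + 1) := by
  intro j
  refine Fin.lastCases ?_ (fun k => ?_) j
  · rw [Fin.snoc_last, obsUpTo_last]
    cases h with
    | zero => exact (not_not.1 hy).symm
    | succ k =>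
      have h1 := hτ (Fin.last k)
      have h2 := not_not.1 hy
      rw [obsUpTo_last] at h1
      simp only [Fin.val_last, stateDecoder, Fin.snoc_castSucc, Fin.snoc_last]
      rw [← h2]
      exact congrArg (fun s => M.next k s (α k (τ (Fin.last k)).1 y.1)) h1
  · have := hτ k
    rw [obsUpTo_snoc_castSucc, Fin.snoc_castSucc]
    exact this

/-- The probability of a decoding error when the observation at step `h` arrives, up to the
importance weight of uniform actions. -/
noncomputable def stepErrorBound (M : MDP S A H) (B : BlockMDP S A X H) (s₀ : S)
    (α : ℕ → X → X → A) (π : Policy X A) : ℕ → ℝ≥0∞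
  | 0 => B.latent.init.toMeasure {s | s ≠ s₀}
  | k + 1 => Fintype.card A * B.sampleLaw π k (shadowError M B k (α k))

/-- The action of `π` is one of the `|A|` equally likely actions of the sampling law, so playing `π`
inflates the error probability at most `|A|`-fold. -/
theorem lintegral_stepError_le (M : MDP S A H) (B : BlockMDP S A X H) (s₀ : S)
    {α : ℕ → X → X → A} (hα : ∀ k, Measurable fun p : X × X => α k p.1 p.2) (π : Policy X A)
    (h : ℕ) :
    ∫⁻ τ, ∑ s, B.nextState π h τ s * B.emit s {x | stepError M B s₀ α h τ x} ∂(B.trajLaw π h) ≤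
      stepErrorBound M B s₀ α π h := by
  classical
  cases h with
  | zero =>
    have hd := B.measurable_decoder
    have h1 : ∀ s, B.emit s {x | B.decoder x ≠ s₀} = if s ≠ s₀ then 1 else 0 := by
      intro s
      have : {x | B.decoder x ≠ s₀} =ᵐ[B.emit s] {x | s ≠ s₀} := by
        filter_upwards [B.decoder_emit s] with x hx
        exact congrArg (fun t => t ≠ s₀) hx
      rw [measure_congr this]
      by_cases hs : s = s₀ <;> simp [hs]
    simp only [stepError, stepErrorBound, BlockMDP.nextState, h1, BlockMDP.trajLaw]
    rw [lintegral_dirac, PMF.toMeasure_apply _ MeasurableSet.of_discrete, tsum_fintype]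
    refine Finset.sum_le_sum fun s _ => ?_
    by_cases hs : s = s₀ <;> simp [hs]
  | succ k =>
    have hE := measurableSet_shadowError M B k (hα k)
    rw [stepErrorBound, ← lintegral_indicator_one hE,
      B.lintegral_sampleLaw π k (measurable_one.indicator hE)]
    rw [← lintegral_const_mul']
    swap; · simp
    refine lintegral_mono fun τ => ?_
    simp only
    rw [← Finset.mul_sum, ← mul_assoc, ENNReal.mul_inv_cancel (by simp) (by simp), one_mul]
    refine le_trans ?_ (Finset.single_le_sum (fun _ _ => zero_le)
      (Finset.mem_univ (π k fun i => (τ i).1)))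
    refine Finset.sum_le_sum fun s _ => mul_le_mul' le_rfl (le_of_eq ?_)
    rw [← lintegral_indicator_one]
    · rfl
    · exact measurable_prodMk_left (measurableSet_stepError M B s₀ hα (k + 1))

/-- Union bound over the time of the first decoding error; later errors need no control. -/
theorem trajLaw_decodedSet_compl_le (M : MDP S A H) (B : BlockMDP S A X H) (s₀ : S)
    {α : ℕ → X → X → A} (hα : ∀ k, Measurable fun p : X × X => α k p.1 p.2) {π : Policy X A}
    (hπ : ∀ k, Measurable (π k)) (h : ℕ) :
    B.trajLaw π h (decodedSet M B s₀ α h)ᶜ ≤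
      ∑ k ∈ Finset.range h, stepErrorBound M B s₀ α π k := by
  classical
  induction h with
  | zero =>
    have : (decodedSet M B s₀ α 0)ᶜ = ∅ := by
      rw [Set.compl_empty_iff, Set.eq_univ_iff_forall]
      exact fun τ k => k.elim0
    simp [this]
  | succ h ih =>
    have hE := fun h => (measurableSet_decodedSet M B s₀ hα h).compl
    have hS := measurableSet_stepError M B s₀ hα h
    rw [Finset.sum_range_succ, ← lintegral_indicator_one (hE _),
      B.lintegral_trajLaw_succ hπ h (measurable_one.indicator (hE _))]
    refine le_trans ?_ (add_le_add ih (lintegral_stepError_le M B s₀ hα π h))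
    rw [← lintegral_indicator_one (hE h), ← lintegral_add_left (measurable_one.indicator (hE h))]
    refine lintegral_mono fun τ => ?_
    simp only
    have hSτ : MeasurableSet {x | stepError M B s₀ α h τ x} := measurable_prodMk_left hS
    calc _ ≤ ∑ s, B.nextState π h τ s * ((decodedSet M B s₀ α h)ᶜ.indicator 1 τ +
          B.emit s {x | stepError M B s₀ α h τ x}) := by
          gcongr with s
          rw [← lintegral_indicator_one hSτ]
          have : (decodedSet M B s₀ α h)ᶜ.indicator (1 : (Fin h → X × S) → ℝ≥0∞) τ =
              ∫⁻ _, (decodedSet M B s₀ α h)ᶜ.indicator (1 : (Fin h → X × S) → ℝ≥0∞) τ ∂(B.emit s) := by simp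
          rw [this, ← lintegral_add_left measurable_const]
          refine lintegral_mono fun x => ?_
          by_cases h1 : τ ∈ decodedSet M B s₀ α h
          · by_cases h2 : stepError M B s₀ α h τ x
            · refine le_trans (Set.indicator_le_self' (fun _ _ => zero_le) _) ?_
              simp [h2]
            · have := snoc_mem_decodedSet (y := (x, s)) h1 h2
              simp [this]
          · refine le_trans (Set.indicator_le_self' (fun _ _ => zero_le) _) ?_
            simp [h1]
      _ = _ := by
          simp_rw [mul_add, Finset.sum_add_distrib, ← Finset.sum_mul, PMF.sum_eq_one, one_mul]

/-- Value loss of the policy `ρ ∘ φ`, for a state decoder `φ` built from shadow action decoders. -/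
theorem value_compDecoder_sub_le (M : MDP S A H) (B : BlockMDP S A X H) (s₀ : S)
    {α : ℕ → X → X → A} (hα : ∀ k, Measurable fun p : X × X => α k p.1 p.2)
    (ρ : AbstractPolicy S A) {π : Policy X A}
    (hπ : ∀ k xs, π k xs = ρ k (stateDecoder M s₀ α k xs)) :
    B.value (B.compDecoder ρ) -
      H * (∑ k ∈ Finset.range H, stepErrorBound M B s₀ α π k).toReal ≤ B.value π := by
  have hd := B.measurable_decoder
  have hρ : ∀ k, Measurable (ρ k) := fun k => Measurable.of_discrete
  have hπm : ∀ k, Measurable (π k) := fun k => by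
    rw [funext (hπ k)]
    exact (hρ k).comp (measurable_stateDecoder M s₀ hα k)
  have hπ'm : ∀ k, Measurable (B.compDecoder ρ k) := fun k =>
    (hρ k).comp (hd.comp (measurable_pi_apply _))
  refine le_trans ?_ (B.value_sub_le hπm hπ'm)
  have := B.isProbabilityMeasure_sampleLaw hπm
  have hfin : ∑ k ∈ Finset.range H, stepErrorBound M B s₀ α π k ≠ ∞ := by
    refine ENNReal.sum_ne_top.2 fun k _ => ?_
    cases k with
    | zero => exact measure_ne_top _ _
    | succ k => exact ENNReal.mul_ne_top (by simp) (measure_ne_top _ _)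
  have hsub : (agreeSet π (B.compDecoder ρ) H)ᶜ ⊆ (decodedSet M B s₀ α H)ᶜ := by
    refine Set.compl_subset_compl.2 fun τ hτ k => ?_
    rw [hπ, hτ k]
    rfl
  have := ENNReal.toReal_mono hfin
    ((measure_mono hsub).trans (trajLaw_decodedSet_compl_le M B s₀ hα hπm H))
  gcongr

end

/-! ### Maximum likelihood over a finite class. -/

section

theorem log_prod {ι : Type*} (s : Finset ι) (f : ι → ℝ≥0∞) :
    ENNReal.log (∏ i ∈ s, f i) = ∑ i ∈ s, ENNReal.log (f i) := by
  classical
  induction s using Finset.induction_on with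
  | empty => simp
  | insert a s ha ih => rw [Finset.prod_insert ha, Finset.sum_insert ha, ENNReal.log_mul_add, ih]

theorem logLikelihood_le_iff {A X : Type*} {n : ℕ} {f g : X → X → PMF A} {D : Fin n → X × A × X} :
    logLikelihood f D ≤ logLikelihood g D ↔
      ∏ i, f (D i).1 (D i).2.2 (D i).2.1 ≤ ∏ i, g (D i).1 (D i).2.2 (D i).2.1 := by
  rw [logLikelihood, logLikelihood, ← log_prod, ← log_prod, ENNReal.log_le_log_iff]

/-- This is the only consequence of likelihood maximization that is used; the square root keeps it
while making the mean of each factor an affinity. -/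
theorem one_le_prod_ratio {ι : Type*} {s : Finset ι} {f g : ι → ℝ≥0∞} (hg : ∀ i ∈ s, g i ≠ 0)
    (hgt : ∀ i ∈ s, g i ≠ ∞) (h : ∏ i ∈ s, g i ≤ ∏ i ∈ s, f i) :
    1 ≤ ∏ i ∈ s, (f i / g i) ^ (1 / 2 : ℝ) := by
  rw [ENNReal.prod_rpow_of_nonneg (by norm_num)]
  refine ENNReal.one_le_rpow ?_ (by norm_num)
  have h1 : ∏ i ∈ s, f i = (∏ i ∈ s, f i / g i) * ∏ i ∈ s, g i := by
    rw [← Finset.prod_mul_distrib]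
    exact Finset.prod_congr rfl fun i hi => (ENNReal.div_mul_cancel (hg i hi) (hgt i hi)).symm
  rw [h1] at h
  have h0 : ∏ i ∈ s, g i ≠ 0 := Finset.prod_ne_zero_iff.2 hg
  have ht : ∏ i ∈ s, g i ≠ ∞ := ENNReal.prod_ne_top hgt
  rwa [← ENNReal.mul_le_mul_iff_left h0 ht, one_mul]

theorem lintegral_pi_prod {Y : Type*} [MeasurableSpace Y] (ν : Measure Y) [IsProbabilityMeasure ν]
    {n : ℕ} {w : Y → ℝ≥0∞} (hw : Measurable w) :
    ∫⁻ D, ∏ k, w (D k) ∂(Measure.pi fun _ : Fin n => ν) = (∫⁻ y, w y ∂ν) ^ n := by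
  have hind := ProbabilityTheory.iIndepFun_pi (μ := fun _ : Fin n => ν) (X := fun _ => w)
    fun _ => hw.aemeasurable
  rw [ProbabilityTheory.lintegral_prod_eq_prod_lintegral_of_indepFun Finset.univ _ hind
    fun i => hw.comp (measurable_pi_apply i)]
  have : ∀ i : Fin n, ∫⁻ D, w (D i) ∂(Measure.pi fun _ : Fin n => ν) = ∫⁻ y, w y ∂ν := fun i =>
    (measurePreserving_eval (fun _ : Fin n => ν) i).lintegral_comp hw
  simp [this]

/-- Exponential moment bound for maximum likelihood estimation over a finite class. -/
theorem lintegral_exp_mle_le {Y ι : Type*} [MeasurableSpace Y] (ν : Measure Y)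
    [IsProbabilityMeasure ν] {F : Finset ι} {lik : ι → Y → ℝ≥0∞}
    (hm : ∀ i ∈ F, Measurable (lik i)) (htop : ∀ i y, lik i y ≠ ∞) {i₀ : ι} (hi₀ : i₀ ∈ F)
    (h0 : ∀ᵐ y ∂ν, lik i₀ y ≠ 0) {n : ℕ} {opt : (Fin n → Y) → ι} (hopt : ∀ D, opt D ∈ F)
    (hmax : ∀ D, ∏ k, lik i₀ (D k) ≤ ∏ k, lik (opt D) (D k)) {r : ι → ℝ}
    (hr : ∀ i ∈ F, ∫⁻ y, (lik i y / lik i₀ y) ^ (1 / 2 : ℝ) ∂ν ≤ ENNReal.ofReal (Real.exp (-r i))) :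
    ∫⁻ D, ENNReal.ofReal (Real.exp (n * r (opt D))) ∂(Measure.pi fun _ : Fin n => ν) ≤ F.card := by
  set w : ι → Y → ℝ≥0∞ := fun i y => (lik i y / lik i₀ y) ^ (1 / 2 : ℝ) with hw
  have hwm : ∀ i ∈ F, Measurable (w i) := fun i hi => ((hm i hi).div (hm i₀ hi₀)).pow_const _
  have hwn : ∀ i ∈ F, Measurable fun D : Fin n → Y => ∏ k, w i (D k) := fun i hi =>
    Finset.measurable_prod _ fun k _ => (hwm i hi).comp (measurable_pi_apply k)
  have hae : ∀ᵐ D ∂(Measure.pi fun _ : Fin n => ν), ∀ k, lik i₀ (D k) ≠ 0 :=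
    Filter.eventually_all.2 fun k =>
      (Measure.tendsto_eval_ae_ae (μ := fun _ : Fin n => ν) (i := k)).eventually h0
  calc _ ≤ ∫⁻ D, ∑ i ∈ F, ENNReal.ofReal (Real.exp (n * r i)) * ∏ k, w i (D k)
        ∂(Measure.pi fun _ : Fin n => ν) := by
        refine lintegral_mono_ae ?_
        filter_upwards [hae] with D hD
        -- The data-dependent choice is removed by summing over `F`: the term of the maximizer alone
        -- dominates, its ratio product being at least `1`.
        refine le_trans ?_ (Finset.single_le_sum
          (f := fun i => ENNReal.ofReal (Real.exp (n * r i)) * ∏ k, w i (D k))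
          (fun _ _ => zero_le) (hopt D))
        exact le_mul_of_one_le_right zero_le
          (one_le_prod_ratio (fun k _ => hD k) (fun k _ => htop _ _) (hmax D))
    _ = ∑ i ∈ F, ENNReal.ofReal (Real.exp (n * r i)) * (∫⁻ y, w i y ∂ν) ^ n := by
        rw [lintegral_finsetSum _ fun i hi => (hwn i hi).const_mul _]
        refine Finset.sum_congr rfl fun i hi => ?_
        rw [lintegral_const_mul _ (hwn i hi), lintegral_pi_prod ν (hwm i hi)]
    _ ≤ ∑ i ∈ F, 1 := by
        refine Finset.sum_le_sum fun i hi => ?_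
        calc _ ≤ ENNReal.ofReal (Real.exp (n * r i)) * ENNReal.ofReal (Real.exp (-r i)) ^ n := by
              gcongr
              exact hr i hi
          _ = 1 := by
              rw [← ENNReal.ofReal_pow (Real.exp_pos _).le, ← Real.exp_nat_mul,
                ← ENNReal.ofReal_mul (Real.exp_pos _).le, ← Real.exp_add]
              simp
    _ = _ := by simp

theorem le_ofReal_exp_neg {I p : ℝ≥0∞} {c : ℝ} (hc : 0 ≤ c) (hp : p ≠ ∞)
    (h : I + ENNReal.ofReal c * p ≤ 1) : I ≤ ENNReal.ofReal (Real.exp (-(c * p.toReal))) := by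
  rw [← ENNReal.ofReal_toReal hp, ← ENNReal.ofReal_mul hc] at h
  calc I ≤ 1 - ENNReal.ofReal (c * p.toReal) :=
        ENNReal.le_sub_of_add_le_right ENNReal.ofReal_ne_top h
    _ = ENNReal.ofReal (1 - c * p.toReal) := by
        rw [ENNReal.ofReal_sub _ (mul_nonneg hc ENNReal.toReal_nonneg), ENNReal.ofReal_one]
    _ ≤ _ := ENNReal.ofReal_le_ofReal (by linarith [Real.add_one_le_exp (-(c * p.toReal))])

variable {S A X : Type*} [Fintype S] [MeasurableSpace S] [MeasurableSingletonClass S]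
  [Fintype A] [Nonempty A] [MeasurableSpace A] [MeasurableSingletonClass A]
  [MeasurableSpace X] {H : ℕ} {F : Finset (X → X → PMF A)} {n : ℕ}

/-- Exponential moment bound for the error probability of the decoder learned from one dataset. -/
theorem lintegral_exp_error_le {B : BlockMDP S A X H} {h : ℕ} {fs : X → X → PMF A}
    (hfs : IsPosterior B h fs) (hfsF : fs ∈ F)
    (hmeas : ∀ f ∈ F, ∀ a, Measurable fun p : X × X => f p.1 p.2 a) {M : MDP S A H}
    (hdet : M.Deterministic) {η : ℝ} (hη : η < 1 / 2) (hpert : MDP.IsPerturbation η M B.latent)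
    (hh : h < H) {π : Policy X A} (hπ : ∀ k, Measurable (π k)) (O : OptOracle F n)
    (G : ArgmaxRule F) :
    ∫⁻ d, ENNReal.ofReal (Real.exp (n * (affinityGap η (Fintype.card A) *
      (B.sampleLaw π h (shadowError M B h (G.pick (O.opt d)))).toReal)))
      ∂(Measure.pi fun _ : Fin n => B.sampleLaw π h) ≤ F.card := by
  have := B.isProbabilityMeasure_sampleLaw hπ h
  have hr : ∀ f ∈ F, ∫⁻ y, (f y.1 y.2.2 y.2.1 / fs y.1 y.2.2 y.2.1) ^ (1 / 2 : ℝ)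
      ∂(B.sampleLaw π h) ≤ ENNReal.ofReal (Real.exp (-(affinityGap η (Fintype.card A) *
        (B.sampleLaw π h (shadowError M B h (G.pick f))).toReal))) := fun f hf =>
    le_ofReal_exp_neg (affinityGap_nonneg _ _) (measure_ne_top _ _)
      (hfs.lintegral_ratio_add_le (hmeas fs hfsF) hdet hη hpert hh hπ (hmeas f hf)
        (G.measurable_pick f hf) (G.pick_max f hf))
  have hm : ∀ f ∈ F, Measurable fun y : X × A × X => f y.1 y.2.2 y.2.1 := fun f hf =>
    measurable_eval_action (hmeas f hf)
  exact lintegral_exp_mle_le (B.sampleLaw π h) (F := F) (i₀ := fs) (n := n)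
    (lik := fun (f : X → X → PMF A) (y : X × A × X) => f y.1 y.2.2 y.2.1) (opt := O.opt)
    (r := fun f => affinityGap η (Fintype.card A) *
      (B.sampleLaw π h (shadowError M B h (G.pick f))).toReal)
    hm (fun f y => PMF.apply_ne_top _ _) hfsF
    (hfs.sampleLaw_eq_zero (hmeas fs hfsF) hπ) O.opt_mem
    (fun D => logLikelihood_le_iff.1 (O.opt_max D fs hfsF)) hr

/-- The correct posterior makes no decoding errors. -/
theorem shadowError_posterior {B : BlockMDP S A X H} {h : ℕ} {fs : X → X → PMF A}
    (hfs : IsPosterior B h fs) (hfsF : fs ∈ F)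
    (hmeas : ∀ f ∈ F, ∀ a, Measurable fun p : X × X => f p.1 p.2 a) {M : MDP S A H}
    (hdet : M.Deterministic) {η : ℝ} (hη : η < 1 / 2) (hpert : MDP.IsPerturbation η M B.latent)
    (hh : h < H) {π : Policy X A} (hπ : ∀ k, Measurable (π k)) (G : ArgmaxRule F) :
    B.sampleLaw π h (shadowError M B h (G.pick fs)) = 0 := by
  have := B.isProbabilityMeasure_sampleLaw hπ h
  -- With `f = fs` the affinity is already `1`, which leaves no room for a positive gap times the
  -- error probability.
  have h1 := hfs.lintegral_ratio_add_le (hmeas fs hfsF) hdet hη hpert hh hπ (hmeas fs hfsF)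
        (G.measurable_pick fs hfsF) (G.pick_max fs hfsF)
  have h2 : ∫⁻ y, (fs y.1 y.2.2 y.2.1 / fs y.1 y.2.2 y.2.1) ^ (1 / 2 : ℝ) ∂(B.sampleLaw π h) =
      1 := by
    rw [lintegral_congr_ae (g := fun _ => 1)]
    · simp
    · filter_upwards [hfs.sampleLaw_eq_zero (hmeas fs hfsF) hπ] with y hy
      rw [ENNReal.div_self hy (PMF.apply_ne_top _ _), ENNReal.one_rpow]
  rw [h2] at h1
  have h3 : ENNReal.ofReal (affinityGap η (Fintype.card A)) *
      B.sampleLaw π h (shadowError M B h (G.pick fs)) = 0 := by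
    have := ENNReal.le_sub_of_add_le_left ENNReal.one_ne_top h1
    simpa using this
  refine (mul_eq_zero.1 h3).resolve_left ?_
  have : 0 < 1 - 2 * η := by linarith
  have : 0 < affinityGap η (Fintype.card A) := by
    unfold affinityGap
    have : (0 : ℝ) < Fintype.card A := by exact_mod_cast Fintype.card_pos
    positivity
  simpa using this

/-! ### The run of the algorithm -/

/-- The shadow action decoders given by the functions `key` learned so far. -/
noncomputable def keyDecoder (G : ArgmaxRule F) {m : ℕ} (key : Fin m → X → X → PMF A) (h : ℕ)
    (x x' : X) : A :=
  if hm : h < m then G.pick (key ⟨h, hm⟩) x x' else Classical.arbitrary A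

/-- The policy given by the functions `key` learned so far. -/
noncomputable def keyPolicy (M : MDP S A H) (s₀ : S) (ρ : AbstractPolicy S A) (G : ArgmaxRule F)
    {m : ℕ} (key : Fin m → X → X → PMF A) : Policy X A :=
  fun k xs => ρ k (stateDecoder M s₀ (keyDecoder G key) k xs)

theorem measurable_keyDecoder (G : ArgmaxRule F) {m : ℕ} {key : Fin m → X → X → PMF A}
    (hkey : ∀ i, key i ∈ F) (h : ℕ) : Measurable fun p : X × X => keyDecoder G key h p.1 p.2 := by
  unfold keyDecoder
  split_ifs
  · exact G.measurable_pick _ (hkey _)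
  · exact measurable_const

theorem measurable_keyPolicy (M : MDP S A H) (s₀ : S) (ρ : AbstractPolicy S A) (G : ArgmaxRule F)
    {m : ℕ} {key : Fin m → X → X → PMF A} (hkey : ∀ i, key i ∈ F) (k : ℕ) :
    Measurable (keyPolicy M s₀ ρ G key k) :=
  (Measurable.of_discrete (f := ρ k)).comp
    (measurable_stateDecoder M s₀ (measurable_keyDecoder G hkey) k)

theorem keyDecoder_snoc (G : ArgmaxRule F) {m : ℕ} (key : Fin m → X → X → PMF A)
    (f : X → X → PMF A) {h : ℕ} (hm : h < m) :
    keyDecoder G (Fin.snoc (α := fun _ => X → X → PMF A) key f) h = keyDecoder G key h := by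
  funext x x'
  rw [keyDecoder, keyDecoder, dif_pos hm, dif_pos (hm.trans m.lt_succ_self)]
  exact congrArg (fun f => G.pick f x x')
    (Fin.snoc_castSucc (α := fun _ => X → X → PMF A) f key ⟨h, hm⟩)

theorem stateDecoder_congr (M : MDP S A H) (s₀ : S) {α α' : ℕ → X → X → A} {k : ℕ}
    (h : ∀ j < k, α j = α' j) : stateDecoder M s₀ α k = stateDecoder M s₀ α' k := by
  induction k with
  | zero => rfl
  | succ k ih =>
    funext xs
    simp only [stateDecoder, ih fun j hj => h j (hj.trans k.lt_succ_self), h k k.lt_succ_self]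

theorem keyPolicy_snoc (M : MDP S A H) (s₀ : S) (ρ : AbstractPolicy S A) (G : ArgmaxRule F)
    {m : ℕ} (key : Fin m → X → X → PMF A) (f : X → X → PMF A) {k : ℕ} (hk : k ≤ m) :
    keyPolicy M s₀ ρ G (Fin.snoc (α := fun _ => X → X → PMF A) key f) k =
      keyPolicy M s₀ ρ G key k := by
  funext xs
  simp only [keyPolicy]
  rw [stateDecoder_congr M s₀ fun j hj => keyDecoder_snoc G key f (hj.trans_le hk)]

/-- The probability, under the sampling law of step `i`, that the `i`-th decoder errs. -/
noncomputable def keyError (B : BlockMDP S A X H) (M : MDP S A H) (s₀ : S)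
    (ρ : AbstractPolicy S A) (G : ArgmaxRule F) {m : ℕ} (key : Fin m → X → X → PMF A) (i : ℕ) :
    ℝ≥0∞ :=
  B.sampleLaw (keyPolicy M s₀ ρ G key) i (shadowError M B i (keyDecoder G key i))

/-- Sampling at step `i` uses only the policy before step `i`, which later decoders do not change.
Errors at collection time are thus errors of the final policy. -/
theorem keyError_snoc (B : BlockMDP S A X H) (M : MDP S A H) (s₀ : S)
    (ρ : AbstractPolicy S A) (G : ArgmaxRule F) {m : ℕ} (key : Fin m → X → X → PMF A)
    (f : X → X → PMF A) {i : ℕ} (hi : i < m) :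
    keyError B M s₀ ρ G (Fin.snoc (α := fun _ => X → X → PMF A) key f) i =
      keyError B M s₀ ρ G key i := by
  rw [keyError, keyError, keyDecoder_snoc G key f hi,
    B.sampleLaw_congr fun k hk => keyPolicy_snoc M s₀ ρ G key f (hk.trans hi).le]

theorem keyError_snoc_last (B : BlockMDP S A X H) (M : MDP S A H) (s₀ : S)
    (ρ : AbstractPolicy S A) (G : ArgmaxRule F) {m : ℕ} (key : Fin m → X → X → PMF A)
    (f : X → X → PMF A) :
    keyError B M s₀ ρ G (Fin.snoc (α := fun _ => X → X → PMF A) key f) m =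
      B.sampleLaw (keyPolicy M s₀ ρ G key) m (shadowError M B m (G.pick f)) := by
  rw [keyError, B.sampleLaw_congr fun k hk => keyPolicy_snoc M s₀ ρ G key f hk.le]
  congr 2
  funext x x'
  rw [keyDecoder, dif_pos m.lt_succ_self]
  exact congrArg (fun f => G.pick f x x') (Fin.snoc_last (α := fun _ => X → X → PMF A) f key)

/-- The functions learned from the datasets `D`. -/
def learnedKey (O : OptOracle F n) {m : ℕ} (D : Fin m → Fin n → X × A × X) :
    Fin m → X → X → PMF A := fun i => O.opt (D i)

theorem learnedKey_snoc (O : OptOracle F n) {m : ℕ} (D : Fin m → Fin n → X × A × X)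
    (d : Fin n → X × A × X) :
    learnedKey O (Fin.snoc (α := fun _ => Fin n → X × A × X) D d) =
      Fin.snoc (α := fun _ => X → X → PMF A) (learnedKey O D) (O.opt d) := by
  funext i
  refine Fin.lastCases ?_ (fun j => ?_) i
  · simp [learnedKey]
  · simp [learnedKey]

theorem learnedPolicy_eq (M : MDP S A H) (s₀ : S) (ρ : AbstractPolicy S A) (O : OptOracle F n)
    (G : ArgmaxRule F) {m : ℕ} (D : Fin m → Fin n → X × A × X) :
    learnedPolicy M s₀ ρ O G D = keyPolicy M s₀ ρ G (learnedKey O D) := rfl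

/-- The data enter the policies only through the learned tuple, which takes finitely many values on
measurable cells; measurability for each fixed tuple is enough. -/
theorem measurable_of_learnedKey (O : OptOracle F n) {m : ℕ}
    {g : (Fin m → X → X → PMF A) → (Fin m → Fin n → X × A × X) → ℝ≥0∞}
    (hg : ∀ key, (∀ i, key i ∈ F) → Measurable (g key)) :
    Measurable fun D => g (learnedKey O D) D := by
  classical
  have : (fun D => g (learnedKey O D) D) = fun D => ∑ key ∈ Fintype.piFinset fun _ : Fin m => F,
      {D | learnedKey O D = key}.indicator (g key) D := by
    funext D
    rw [Finset.sum_eq_single (learnedKey O D)]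
    · simp
    · intro key _ hne
      exact Set.indicator_of_notMem (fun h => hne h.symm) _
    · intro h
      exact absurd (Fintype.mem_piFinset.2 fun i => O.opt_mem (D i)) h
  rw [this]
  refine Finset.measurable_sum _ fun key hkey =>
    (hg key (Fintype.mem_piFinset.1 hkey)).indicator ?_
  have : {D : Fin m → Fin n → X × A × X | learnedKey O D = key} =
      ⋂ i, (fun D => D i) ⁻¹' {d | O.opt d = key i} := by
    ext D; simp [funext_iff, learnedKey]
  rw [this]
  exact MeasurableSet.iInter fun i => measurable_pi_apply i (O.measurableSet_opt _)

theorem lintegral_dataLaw_succ (B : BlockMDP S A X H) (M : MDP S A H) (s₀ : S)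
    (ρ : AbstractPolicy S A) (O : OptOracle F n) (G : ArgmaxRule F) (m : ℕ)
    {g : (Fin (m + 1) → Fin n → X × A × X) → ℝ≥0∞} (hg : Measurable g) :
    ∫⁻ D, g D ∂(dataLaw B M s₀ ρ O G (m + 1)) =
      ∫⁻ D, ∫⁻ d, g (Fin.snoc (α := fun _ => Fin n → X × A × X) D d)
        ∂(Measure.pi fun _ : Fin n => B.sampleLaw (learnedPolicy M s₀ ρ O G D) m)
        ∂(dataLaw B M s₀ ρ O G m) := by
  have hsnoc := measurable_snoc (Y := Fin n → X × A × X) m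
  have key : ∀ (D : Fin m → Fin n → X × A × X) (g : (Fin (m + 1) → Fin n → X × A × X) → ℝ≥0∞),
      Measurable g → ∫⁻ y, g y
        ∂((Measure.pi fun _ : Fin n => B.sampleLaw (learnedPolicy M s₀ ρ O G D) m).map
          fun d => Fin.snoc (α := fun _ => Fin n → X × A × X) D d) =
      ∫⁻ d, g (Fin.snoc (α := fun _ => Fin n → X × A × X) D d)
        ∂(Measure.pi fun _ : Fin n => B.sampleLaw (learnedPolicy M s₀ ρ O G D) m) :=
    fun D g hg => lintegral_map hg (hsnoc.comp measurable_prodMk_left)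
  rw [dataLaw, Measure.lintegral_bind _ hg.aemeasurable]
  · simp_rw [key _ g hg]
  · refine (measurable_of_lintegral fun g hg => ?_).aemeasurable
    simp_rw [key _ g hg, learnedPolicy_eq]
    refine measurable_of_learnedKey O (g := fun key D =>
      ∫⁻ d, g (Fin.snoc (α := fun _ => Fin n → X × A × X) D d)
        ∂(Measure.pi fun _ : Fin n => B.sampleLaw (keyPolicy M s₀ ρ G key) m)) fun key hkey => ?_
    have := B.isProbabilityMeasure_sampleLaw (measurable_keyPolicy M s₀ ρ G hkey) m
    exact Measurable.lintegral_prod_right' (f := fun q : _ × _ =>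
      g (Fin.snoc (α := fun _ => Fin n → X × A × X) q.1 q.2)) (hg.comp hsnoc)

theorem measurable_learnedPolicy (M : MDP S A H) (s₀ : S) (ρ : AbstractPolicy S A)
    (O : OptOracle F n) (G : ArgmaxRule F) {m : ℕ} (D : Fin m → Fin n → X × A × X) (k : ℕ) :
    Measurable (learnedPolicy M s₀ ρ O G D k) :=
  measurable_keyPolicy M s₀ ρ G (fun i => O.opt_mem (D i)) k

theorem isProbabilityMeasure_dataLaw (B : BlockMDP S A X H) (M : MDP S A H) (s₀ : S)
    (ρ : AbstractPolicy S A) (O : OptOracle F n) (G : ArgmaxRule F) (m : ℕ) :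
    IsProbabilityMeasure (dataLaw B M s₀ ρ O G m) := by
  induction m with
  | zero => rw [dataLaw]; infer_instance
  | succ m ih =>
    have h1 : ∀ D : Fin m → Fin n → X × A × X,
        IsProbabilityMeasure (B.sampleLaw (learnedPolicy M s₀ ρ O G D) m) := fun D =>
      B.isProbabilityMeasure_sampleLaw (measurable_learnedPolicy M s₀ ρ O G D) m
    constructor
    have := lintegral_dataLaw_succ B M s₀ ρ O G m (g := fun _ => 1) measurable_const
    simpa using this

/-- Exponential moment bound for the accumulated error of the decoders of a run. -/
theorem lintegral_exp_keyError_le (B : BlockMDP S A X H) (M : MDP S A H) (s₀ : S)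
    (ρ : AbstractPolicy S A) (O : OptOracle F n) (G : ArgmaxRule F)
    (hmeas : ∀ f ∈ F, ∀ a, Measurable fun p : X × X => f p.1 p.2 a) (hreal : B.Realizable F)
    (hdet : M.Deterministic) {η : ℝ} (hη : η < 1 / 2) (hpert : MDP.IsPerturbation η M B.latent)
    {m : ℕ} (hm : m ≤ H - 1) :
    ∫⁻ D, ENNReal.ofReal (Real.exp (n * (affinityGap η (Fintype.card A) *
      ∑ i ∈ Finset.range m, (keyError B M s₀ ρ G (learnedKey O D) i).toReal)))
      ∂(dataLaw B M s₀ ρ O G m) ≤ (F.card : ℝ≥0∞) ^ m := by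
  induction m with
  | zero => simp [dataLaw]
  | succ m ih =>
    have hmm : Measurable fun D : Fin (m + 1) → Fin n → X × A × X =>
        ENNReal.ofReal (Real.exp (n * (affinityGap η (Fintype.card A) *
          ∑ i ∈ Finset.range (m + 1), (keyError B M s₀ ρ G (learnedKey O D) i).toReal))) :=
      measurable_of_learnedKey O (g := fun key _ =>
        ENNReal.ofReal (Real.exp (n * (affinityGap η (Fintype.card A) *
          ∑ i ∈ Finset.range (m + 1), (keyError B M s₀ ρ G key i).toReal))))
        fun _ _ => measurable_const
    rw [lintegral_dataLaw_succ B M s₀ ρ O G m hmm]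
    obtain ⟨fs, hfsF, hfs⟩ := hreal m (by omega)
    -- Given the first `m` datasets the earlier errors are constants, and the new factor has
    -- conditional mean at most `|F|`.
    refine (lintegral_mono (g := fun D => ENNReal.ofReal (Real.exp (n *
      (affinityGap η (Fintype.card A) * ∑ i ∈ Finset.range m,
        (keyError B M s₀ ρ G (learnedKey O D) i).toReal))) * F.card) fun D => ?_).trans ?_
    · refine le_trans (le_of_eq ?_) (mul_le_mul' le_rfl
        (lintegral_exp_error_le hfs hfsF hmeas hdet hη hpert (by omega)
          (measurable_learnedPolicy M s₀ ρ O G D) O G))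
      rw [← lintegral_const_mul' _ _ ENNReal.ofReal_ne_top]
      refine lintegral_congr fun d => ?_
      have hs : ∑ i ∈ Finset.range m, (keyError B M s₀ ρ G (Fin.snoc
            (α := fun _ => X → X → PMF A) (learnedKey O D) (O.opt d)) i).toReal =
          ∑ i ∈ Finset.range m, (keyError B M s₀ ρ G (learnedKey O D) i).toReal :=
        Finset.sum_congr rfl fun i hi => by
          rw [keyError_snoc _ _ _ _ _ _ _ (Finset.mem_range.1 hi)]
      rw [learnedKey_snoc, Finset.sum_range_succ, hs, keyError_snoc_last,
        ← ENNReal.ofReal_mul (Real.exp_pos _).le, ← Real.exp_add, ← mul_add, ← mul_add,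
        learnedPolicy_eq]
    · rw [lintegral_mul_const' _ _ (by simp), pow_succ]
      gcongr
      exact ih (by omega)

end

/-! ### Sample size and final assembly. -/

section

theorem log_card_div_nonneg (N : ℕ) {δ : ℝ} (hδ : δ ∈ Set.Ioo (0 : ℝ) 1) :
    0 ≤ Real.log (N / δ) := by
  rcases Nat.eq_zero_or_pos N with rfl | hN
  · simp
  · refine Real.log_nonneg ((one_le_div hδ.1).2 (hδ.2.le.trans ?_))
    exact_mod_cast hN

theorem episodes_sampleSize_le (H a N : ℕ) {η ε δ : ℝ} (hε : 0 < ε)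
    (hδ : δ ∈ Set.Ioo (0 : ℝ) 1) :
    (episodes H (sampleSize H a N η ε δ) : ℝ) ≤
      8 * (H : ℝ) ^ 3 * (a : ℝ) ^ 3 * Real.log (N / δ) / (ε * (1 - 2 * η) ^ 2) := by
  have hL := log_card_div_nonneg N hδ
  have hX : 0 ≤ 8 * (H : ℝ) ^ 2 * (a : ℝ) ^ 3 * Real.log (N / δ) / (ε * (1 - 2 * η) ^ 2) := by
    positivity
  have h1 : ((H - 1 : ℕ) : ℝ) ≤ H := by exact_mod_cast Nat.sub_le H 1
  calc _ = ((H - 1 : ℕ) : ℝ) * (sampleSize H a N η ε δ : ℝ) := by simp [episodes]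
    _ ≤ H * (8 * (H : ℝ) ^ 2 * (a : ℝ) ^ 3 * Real.log (N / δ) / (ε * (1 - 2 * η) ^ 2)) :=
        mul_le_mul h1 (Nat.floor_le hX) (Nat.cast_nonneg _) (Nat.cast_nonneg _)
    _ = _ := by ring

/-- Either the accuracy is trivial, or rounding down the sample size loses at most a factor `2`. -/
theorem horizon_le_or_le_two_mul {H a N n : ℕ} {η ε δ : ℝ} (hH : 0 < H) (ha : 0 < a) (hN : 2 ≤ N)
    (hη0 : 0 ≤ η) (hη : η < 1 / 2) (hε : 0 < ε) (hδ : δ ∈ Set.Ioo (0 : ℝ) 1)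
    (hn : sampleSize H a N η ε δ ≤ n) :
    (H : ℝ) ≤ ε ∨ (0 < n ∧
      4 * (H : ℝ) ^ 2 * (a : ℝ) ^ 3 * Real.log (N / δ) ≤ n * (ε * (1 - 2 * η) ^ 2)) := by
  have hw : 0 < (1 - 2 * η) ^ 2 := pow_pos (by linarith) 2
  have hw1 : (1 - 2 * η) ^ 2 ≤ 1 := by nlinarith
  have hH1 : (1 : ℝ) ≤ H := by exact_mod_cast hH
  have ha1 : (1 : ℝ) ≤ a := by exact_mod_cast ha
  have hN2 : (2 : ℝ) ≤ N := by exact_mod_cast hN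
  set X := 8 * (H : ℝ) ^ 2 * (a : ℝ) ^ 3 * Real.log (N / δ) / (ε * (1 - 2 * η) ^ 2) with hX
  rcases lt_or_ge X 1 with h | h
  · left
    rw [hX, div_lt_one (by positivity)] at h
    -- Two functions in the class keep the logarithm above `log 2 > 1 / 2`, so a sample size that
    -- rounds to `0` is possible only for `ε` larger than `H`.
    have hL : (1 / 2 : ℝ) ≤ Real.log (N / δ) := by
      have h2 : Real.log 2 ≤ Real.log (N / δ) :=
        Real.log_le_log (by norm_num) ((le_div_iff₀ hδ.1).2 (by nlinarith [hδ.1, hδ.2]))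
      linarith [Real.log_two_gt_d9]
    have h3 : (1 : ℝ) ≤ (a : ℝ) ^ 3 := one_le_pow₀ ha1
    have h4 : ε * (1 - 2 * η) ^ 2 ≤ ε := mul_le_of_le_one_right hε.le hw1
    have h5 : (H : ℝ) ≤ (H : ℝ) ^ 2 := by nlinarith
    have h6 : (H : ℝ) ^ 2 * 1 ≤ (H : ℝ) ^ 2 * (a : ℝ) ^ 3 :=
      mul_le_mul_of_nonneg_left h3 (by positivity)
    have h7 : (H : ℝ) ^ 2 * (a : ℝ) ^ 3 * (1 / 2) ≤ (H : ℝ) ^ 2 * (a : ℝ) ^ 3 * Real.log (N / δ) :=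
      mul_le_mul_of_nonneg_left hL (by positivity)
    nlinarith
  · right
    have h1 : 1 ≤ ⌊X⌋₊ := (Nat.one_le_floor_iff X).2 h
    have h2 := Nat.lt_floor_add_one X
    have h3 : ((⌊X⌋₊ : ℕ) : ℝ) ≤ n := by exact_mod_cast hn
    have h4 : (1 : ℝ) ≤ (⌊X⌋₊ : ℕ) := by exact_mod_cast h1
    refine ⟨h1.trans hn, ?_⟩
    have h5 : X ≤ 2 * n := by linarith
    rw [hX, div_le_iff₀ (by positivity)] at h5
    linarith

variable {S A X : Type*} [Fintype S] [MeasurableSpace S] [MeasurableSingletonClass S]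
  [Fintype A] [Nonempty A] [MeasurableSpace A] [MeasurableSingletonClass A]
  [MeasurableSpace X] {H : ℕ} {F : Finset (X → X → PMF A)} {n : ℕ}

theorem value_learnedPolicy_ge (M : MDP S A H) (B : BlockMDP S A X H) (s₀ : S)
    (ρ : AbstractPolicy S A) (O : OptOracle F n) (G : ArgmaxRule F)
    (D : Fin (H - 1) → Fin n → X × A × X) :
    B.value (B.compDecoder ρ) - H * ((B.latent.init.toMeasure {s | s ≠ s₀}).toReal +
        Fintype.card A * ∑ i ∈ Finset.range (H - 1),
          (keyError B M s₀ ρ G (learnedKey O D) i).toReal) ≤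
      B.value (learnedPolicy M s₀ ρ O G D) := by
  have h := value_compDecoder_sub_le M B s₀ (measurable_keyDecoder G fun i => O.opt_mem (D i)) ρ
    (π := learnedPolicy M s₀ ρ O G D) fun k xs => rfl
  have hprob := B.isProbabilityMeasure_sampleLaw (measurable_learnedPolicy M s₀ ρ O G D)
  cases H with
  | zero => simpa using h
  | succ H =>
    convert h using 3
    -- Index `0` is split off: it is the wrong initial state, while the remaining indices belong to
    -- the `H - 1` decoders.
    rw [Finset.sum_range_succ', ENNReal.toReal_add, ENNReal.toReal_sum, add_comm, Finset.mul_sum]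
    · simp only [stepErrorBound, ENNReal.toReal_mul, ENNReal.toReal_natCast]
      rfl
    · exact fun k _ => ENNReal.mul_ne_top (by simp) (measure_ne_top _ _)
    · exact ENNReal.sum_ne_top.2 fun k _ => ENNReal.mul_ne_top (by simp) (measure_ne_top _ _)
    · exact measure_ne_top _ _

/-- With a single realizable function there are no decoding errors. -/
theorem keyError_eq_zero_of_card_le_one (B : BlockMDP S A X H) (M : MDP S A H) (s₀ : S)
    (ρ : AbstractPolicy S A) (O : OptOracle F n) (G : ArgmaxRule F)
    (hmeas : ∀ f ∈ F, ∀ a, Measurable fun p : X × X => f p.1 p.2 a) (hreal : B.Realizable F)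
    (hdet : M.Deterministic) {η : ℝ} (hη : η < 1 / 2) (hpert : MDP.IsPerturbation η M B.latent)
    (hF : F.card ≤ 1) (D : Fin (H - 1) → Fin n → X × A × X) {i : ℕ} (hi : i < H - 1) :
    keyError B M s₀ ρ G (learnedKey O D) i = 0 := by
  obtain ⟨fs, hfsF, hfs⟩ := hreal i (by omega)
  have hdec : keyDecoder G (learnedKey O D) i = G.pick fs := by
    funext x x'
    rw [keyDecoder, dif_pos hi]
    exact congrArg (fun f => G.pick f x x')
      (Finset.card_le_one.1 hF _ (O.opt_mem (D ⟨i, hi⟩)) _ hfsF)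
  rw [keyError, hdec]
  exact shadowError_posterior hfs hfsF hmeas hdet hη hpert (by omega)
    (measurable_learnedPolicy M s₀ ρ O G D) G

/-- With high probability the accumulated error of the learned decoders is small. -/
theorem dataLaw_keyError_compl_le (B : BlockMDP S A X H) (M : MDP S A H) (s₀ : S)
    (ρ : AbstractPolicy S A) (O : OptOracle F n) (G : ArgmaxRule F)
    (hmeas : ∀ f ∈ F, ∀ a, Measurable fun p : X × X => f p.1 p.2 a) (hreal : B.Realizable F)
    (hdet : M.Deterministic) {η : ℝ} (hη : η < 1 / 2) (hpert : MDP.IsPerturbation η M B.latent)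
    (hF : 0 < F.card) (hH : 0 < H) {δ : ℝ} (hδ : δ ∈ Set.Ioo (0 : ℝ) 1) :
    dataLaw B M s₀ ρ O G (H - 1)
      {D | ¬ n * (affinityGap η (Fintype.card A) * ∑ i ∈ Finset.range (H - 1),
        (keyError B M s₀ ρ G (learnedKey O D) i).toReal) ≤ H * Real.log (F.card / δ)} ≤
      ENNReal.ofReal δ := by
  have hmgf := lintegral_exp_keyError_le B M s₀ ρ O G hmeas hreal hdet hη hpert le_rfl
  set Φ : (Fin (H - 1) → Fin n → X × A × X) → ℝ := fun D =>
    n * (affinityGap η (Fintype.card A) * ∑ i ∈ Finset.range (H - 1),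
        (keyError B M s₀ ρ G (learnedKey O D) i).toReal) with hΦ
  have hmm : Measurable fun D => ENNReal.ofReal (Real.exp (Φ D)) :=
    measurable_of_learnedKey O (g := fun key _ => ENNReal.ofReal (Real.exp (n *
      (affinityGap η (Fintype.card A) * ∑ i ∈ Finset.range (H - 1),
        (keyError B M s₀ ρ G key i).toReal)))) fun _ _ => measurable_const
  have hN : (1 : ℝ) ≤ F.card := by exact_mod_cast hF
  have hN0 : (0 : ℝ) < F.card := by linarith
  set K : ℝ := (F.card : ℝ) ^ (H - 1) with hK
  have hK0 : 0 < K := by positivity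
  have hKE : (F.card : ℝ≥0∞) ^ (H - 1) = ENNReal.ofReal K := by
    rw [hK, ENNReal.ofReal_pow hN0.le, ENNReal.ofReal_natCast]
  have hlog : Real.log (K / δ) ≤ H * Real.log (F.card / δ) := by
    rw [Real.log_div hK0.ne' hδ.1.ne', Real.log_div hN0.ne' hδ.1.ne', hK, Real.log_pow]
    have h1 : Real.log δ ≤ 0 := Real.log_nonpos hδ.1.le hδ.2.le
    have h2 := Real.log_nonneg hN
    have h3 : ((H - 1 : ℕ) : ℝ) ≤ H := by exact_mod_cast Nat.sub_le H 1
    have h4 : (1 : ℝ) ≤ H := by exact_mod_cast hH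
    nlinarith
  have hsub : {D | ¬ Φ D ≤ H * Real.log (F.card / δ)} ⊆
      {D | ENNReal.ofReal (K / δ) ≤ ENNReal.ofReal (Real.exp (Φ D))} := by
    intro D hD
    refine ENNReal.ofReal_le_ofReal ?_
    rw [← Real.log_le_iff_le_exp (div_pos hK0 hδ.1)]
    exact hlog.trans (not_le.1 hD).le
  refine (measure_mono hsub).trans ?_
  -- A single Markov inequality at level `|F| ^ (H - 1) / δ` covers all steps.
  have hmarkov := (mul_meas_ge_le_lintegral (μ := dataLaw B M s₀ ρ O G (H - 1)) hmm
    (ENNReal.ofReal (K / δ))).trans hmgf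
  have hpos : ENNReal.ofReal (K / δ) ≠ 0 := by simpa using div_pos hK0 hδ.1
  rw [hKE] at hmarkov
  rw [← ENNReal.mul_le_mul_iff_right hpos ENNReal.ofReal_ne_top]
  refine hmarkov.trans (le_of_eq ?_)
  rw [← ENNReal.ofReal_mul (div_pos hK0 hδ.1).le, div_mul_cancel₀ _ hδ.1.ne']

theorem dataLaw_value_ge (M : MDP S A H) (s₀ : S) (hdet : M.Deterministic)
    (B : BlockMDP S A X H) {η : ℝ} (hη : η < 1 / 2) (hpert : MDP.IsPerturbation η M B.latent)
    (hmeas : ∀ f ∈ F, ∀ a, Measurable fun p : X × X => f p.1 p.2 a) (hreal : B.Realizable F)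
    {ε δ : ℝ} (hε : 0 < ε) (hδ : δ ∈ Set.Ioo (0 : ℝ) 1) (ρ : AbstractPolicy S A)
    (hn : sampleSize H (Fintype.card A) F.card η ε δ ≤ n) (O : OptOracle F n)
    (G : ArgmaxRule F) :
    ENNReal.ofReal (1 - δ) ≤ dataLaw B M s₀ ρ O G (H - 1)
      {D | B.value (learnedPolicy M s₀ ρ O G D) ≥ B.value (B.compDecoder ρ) - ε -
        H * (B.latent.init.toMeasure {s | s ≠ s₀}).toReal} := by
  have := isProbabilityMeasure_dataLaw B M s₀ ρ O G (H - 1)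
  set E := {D : Fin (H - 1) → Fin n → X × A × X | B.value (learnedPolicy M s₀ ρ O G D) ≥
    B.value (B.compDecoder ρ) - ε - H * (B.latent.init.toMeasure {s | s ≠ s₀}).toReal} with hE
  -- Passing to the complement by subadditivity avoids having to know that the event is measurable.
  suffices h : dataLaw B M s₀ ρ O G (H - 1) Eᶜ ≤ ENNReal.ofReal δ by
    have h1 := measure_univ_le_add_compl (μ := dataLaw B M s₀ ρ O G (H - 1)) E
    rw [measure_univ] at h1
    rw [ENNReal.ofReal_sub _ hδ.1.le, ENNReal.ofReal_one, tsub_le_iff_right]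
    exact h1.trans (by gcongr)
  have hval := value_learnedPolicy_ge M B s₀ ρ O G
  have hgood : ∀ D, H * (Fintype.card A * ∑ i ∈ Finset.range (H - 1),
      (keyError B M s₀ ρ G (learnedKey O D) i).toReal) ≤ ε → D ∈ E := fun D hD => by
    have := hval D
    simp only [hE, Set.mem_ofPred_eq, ge_iff_le]
    linarith
  have huniv : (∀ D, D ∈ E) → dataLaw B M s₀ ρ O G (H - 1) Eᶜ ≤ ENNReal.ofReal δ := fun h => by
    rw [Set.eq_univ_of_forall h]
    simp
  -- A single function gives no lower bound on `log (|F| / δ)`, so the sample may be empty; but then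
  -- the oracle must return the posterior, which never errs.
  rcases le_or_gt F.card 1 with hF | hF
  · refine huniv fun D => hgood D ?_
    rw [Finset.sum_eq_zero fun i hi => ?_]
    · simpa using hε.le
    · rw [keyError_eq_zero_of_card_le_one B M s₀ ρ O G hmeas hreal hdet hη hpert hF D
        (Finset.mem_range.1 hi), ENNReal.toReal_zero]
  rcases Nat.eq_zero_or_pos H with hH | hH
  · refine huniv fun D => hgood D ?_
    simpa [hH] using hε.le
  have hη0 : 0 ≤ η := by
    obtain ⟨ξ, hξ, -⟩ := hpert
    have := hξ 0 hH s₀ (Classical.arbitrary A)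
    linarith [(ξ 0 s₀ (Classical.arbitrary A)).toReal_le_one (Classical.arbitrary A)]
  -- If `H ≤ ε` the claim is trivial, as values lie in `[0, H]`. Otherwise the total error bound,
  -- multiplied by `H * |A|`, falls below `ε`.
  rcases horizon_le_or_le_two_mul hH (Fintype.card_pos (α := A)) hF hη0 hη hε hδ hn with
    h | ⟨hn0, h⟩
  · refine huniv fun D => ?_
    have h1 := (B.value_mem (measurable_learnedPolicy M s₀ ρ O G D)).1
    have h2 := (B.value_mem (π := B.compDecoder ρ) fun k =>
      (Measurable.of_discrete (f := ρ k)).comp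
        (B.measurable_decoder.comp (measurable_pi_apply _))).2
    have h3 : 0 ≤ (H : ℝ) * (B.latent.init.toMeasure {s | s ≠ s₀}).toReal := by positivity
    simp only [hE, Set.mem_ofPred_eq, ge_iff_le]
    linarith
  · refine (measure_mono ?_).trans
      (dataLaw_keyError_compl_le B M s₀ ρ O G hmeas hreal hdet hη hpert (by omega) hH hδ)
    refine fun D hD hle => hD (hgood D ?_)
    set err := ∑ i ∈ Finset.range (H - 1), (keyError B M s₀ ρ G (learnedKey O D) i).toReal
    have ha : (0 : ℝ) < Fintype.card A := by exact_mod_cast Fintype.card_pos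
    have hw : 0 < (n : ℝ) * (1 - 2 * η) ^ 2 := by
      have h1 : 0 < 1 - 2 * η := by linarith
      have h2 : (0 : ℝ) < n := by exact_mod_cast hn0
      positivity
    have h1 : n * (1 - 2 * η) ^ 2 * err ≤
        4 * (Fintype.card A : ℝ) ^ 2 * (H * Real.log (F.card / δ)) := by
      rw [affinityGap, div_mul_eq_mul_div, mul_div_assoc', div_le_iff₀ (by positivity)] at hle
      linarith
    refine le_of_mul_le_mul_left ?_ hw
    calc _ = H * Fintype.card A * (n * (1 - 2 * η) ^ 2 * err) := by ring
      _ ≤ H * Fintype.card A *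
          (4 * (Fintype.card A : ℝ) ^ 2 * (H * Real.log (F.card / δ))) := by gcongr
      _ = 4 * (H : ℝ) ^ 2 * (Fintype.card A : ℝ) ^ 3 * Real.log (F.card / δ) := by ring
      _ ≤ n * (ε * (1 - 2 * η) ^ 2) := h
      _ = _ := by ring

end

end TASID

theorem mainTheorem2
    {S A X : Type*} [Fintype S] [MeasurableSpace S] [MeasurableSingletonClass S]
    [Fintype A] [Nonempty A] [MeasurableSpace A] [MeasurableSingletonClass A]
    [MeasurableSpace X] {H : ℕ}
    -- the deterministic abstract simulator, with initial state `s₀`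
    (M : MDP S A H) (s₀ : S) (hinit : M.init = PMF.pure s₀) (hdet : M.Deterministic)
    -- the target environment; its initial state differs from `s₀` with probability `ε₀`
    (B : BlockMDP S A X H) (η : ℝ) (hη : η < 1 / 2) (hpert : MDP.IsPerturbation η M B.latent)
    (ε₀ : ℝ) (hε₀ : ε₀ = (B.latent.init.toMeasure {s | s ≠ s₀}).toReal)
    -- the function class
    (F : Finset (X → X → PMF A))
    (hmeas : ∀ f ∈ F, ∀ a, Measurable fun p : X × X => f p.1 p.2 a)
    (hreal : B.Realizable F)
    (ε δ : ℝ) (hε : 0 < ε) (hδ : δ ∈ Set.Ioo (0 : ℝ) 1)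
    -- the abstract policy returned by robust dynamic programming
    (ρ : AbstractPolicy S A) (hρ : M.IsRDPOutput η ρ) :
    M.IsRobust η ρ ∧
    (episodes H (sampleSize H (Fintype.card A) F.card η ε δ) : ℝ) ≤
      8 * (H : ℝ) ^ 3 * (Fintype.card A : ℝ) ^ 3 * Real.log (F.card / δ) /
        (ε * (1 - 2 * η) ^ 2) ∧
    ∀ n : ℕ, sampleSize H (Fintype.card A) F.card η ε δ ≤ n →
      ∀ (O : OptOracle F n) (G : ArgmaxRule F),
        ENNReal.ofReal (1 - δ) ≤
          dataLaw B M s₀ ρ O G (H - 1)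
            {D | B.value (learnedPolicy M s₀ ρ O G D) ≥
              B.value (B.compDecoder ρ) - ε - H * ε₀} := by
  subst hε₀
  exact ⟨M.isRobust_of_isRDPOutput hη hpert hρ, episodes_sampleSize_le H _ _ hε hδ,
    fun n hn O G => dataLaw_value_ge M s₀ hdet B hη hpert hmeas hreal hε hδ ρ hn O G⟩
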